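/- Notation. For $x,y\ge 0$ and a fixed constant $A\ge 1$ write $x\sim y$ if $A^{-1}y\le x\le Ay$. For $j\in\mathbb N=\{0,1,2,\dots\}$ and $k\in\mathbb R^2$ let $\tau^j_k\subset\mathbb R^2$ be the closed axis-parallel square of side length $2^{-j}$ with lower-left vertex $k$; for $w\in\mathbb S^1$ and $m\in\mathbb R^2$ let $$\mathfrak t^{j}_{w,m}=\{\xi\in[0,2]^2:\ |\xi-m-((\xi-m)\cdot w)\,w|\le 2^{-j}\}.$$ Let $d(\cdot,\cdot)$ be the distance between two sets. A tube $T\subset\mathbb R^3$ is the closed $1$-neighbourhood of a line with unit direction $d(T)$. For a point $p=(\xi,\tfrac12|\xi|^2)$ of the paraboloid let $n(p)=(\xi,-1)/\sqrt{1+|\xi|^2}$ be the unit normal. Let $r,j,t\in\mathbb N$ with $r\le j$, $w\in\mathbb S^1$, $m\in\mathbb R^2$. Finite families $\mathcal T_1,\mathcal T_2,\mathcal T_3$ of tubes (repetitions are allowed) are of $(r,j,t,w,m)$-type (with constant $A$) if there are $S_1,S_2,S_3\subset\{(\xi,\tfrac12|\xi|^2):|\xi|\le 2\}$ and $\theta$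 such that * $|n(p_1)\wedge n(p_2)\wedge n(p_3)|\sim\theta$ for all $p_1\in S_1$, $p_2\in S_2$, $p_3\in S_3$; * for each $n$ and every $T\in\mathcal T_n$ we have $d(T)=n(p)$ for some $p\in S_n$; * possibly after reordering the sets $S_n$, for some $k,k',k''\in\mathbb R^2$ and $w'\in\mathbb S^1$, $$S_1\subset\{(\xi,\tfrac12|\xi|^2):\xi\in\tau^j_k\cap\mathfrak t^{j+t}_{w,m}\},\quad S_2\subset\{(\xi,\tfrac12|\xi|^2):\xi\in\tau^j_{k'}\cap\mathfrak t^{j+t}_{w,m}\},\quad S_3\subset\{(\xi,\tfrac12|\xi|^2):\xi\in\tau^r_{k''}\cap\mathfrak t^{r+t}_{w',m}\},$$ with $m\in\tau^j_k$, $d(\tau^j_k,\tau^j_{k'})\sim2^{-j}$, $d(\tau^j_{k'},\tau^r_{k''})\sim2^{-r}$, $d(\tau^j_k,\tau^r_{k''})\sim2^{-r}$, $|w-w'|\sim2^{-t}$ and $\theta\sim2^{-j}2^{-r}2^{-t}$. Theorem. For every $A\ge1$ and every $\epsilon>0$ there is a constant $C_\epsilon<\infty$, depending only on $\epsilon$ and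 $A$, such that for all $r,j,t,w,m$, all families $\mathcal T_1,\mathcal T_2,\mathcal T_3$ of $(r,j,t,w,m)$-type with constant $A$, and every ball $Q_R\subset\mathbb R^3$ of radius $R>0$ (of radius $R\ge 1$ in case $\epsilon>3$), $$\int_{Q_R}\prod_{n=1}^3\Big(\sum_{T\in\mathcal T_n}\chi_T\Big)^{1/2}\le C_\epsilon\,R^{\epsilon}\,2^{\frac12(j+t+r)}\prod_{n=1}^3|\mathcal T_n|^{1/2}.$$ -/

import Mathlib

open MeasureTheory

noncomputable section

namespace TrilinearKakeya

/-- The plane of frequencies, with the Euclidean norm. -/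
abbrev E2 := EuclideanSpace ℝ (Fin 2)

/-- Three-dimensional Euclidean space. -/
abbrev E3 := EuclideanSpace ℝ (Fin 3)

/-- `x ∼ y` with comparability constant `A`. -/
def Comparable (A x y : ℝ) : Prop := A⁻¹ * y ≤ x ∧ x ≤ A * y

/-- The distance between two sets of the plane, `inf {|x - y| : x ∈ s, y ∈ s'}`. -/
def setDist (s s' : Set E2) : ℝ := sInf (Set.image2 dist s s')

/-- The (closed) square of side length `2 ^ (-j)` whose lower-left vertex is `k`. -/
def square (j : ℕ) (k : E2) : Set E2 :=
  {ξ | ∀ i, k i ≤ ξ i ∧ ξ i ≤ k i + (2 : ℝ) ^ (-(j : ℝ))}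

/-- The strip in `[0, 2]²` of width `2 ^ (-j)` in the direction `w` through the point `m`. -/
def strip (j : ℕ) (w m : E2) : Set E2 :=
  {ξ | (∀ i, 0 ≤ ξ i ∧ ξ i ≤ 2) ∧ ‖ξ - m - inner ℝ (ξ - m) w • w‖ ≤ (2 : ℝ) ^ (-(j : ℝ))}

/-- The point `(ξ, |ξ|² / 2)` of the paraboloid. -/
def lift (ξ : E2) : E3 := !₂[ξ 0, ξ 1, ‖ξ‖ ^ 2 / 2]

/-- The unit normal `(ξ, -1) / √(1 + |ξ|²)` of the paraboloid at its point `p = (ξ, |ξ|² / 2)`. -/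
def unitNormal (p : E3) : E3 := (√(1 + p 0 ^ 2 + p 1 ^ 2))⁻¹ • !₂[p 0, p 1, -1]

/-- `|u ∧ v ∧ z|`, the volume of the parallelepiped spanned by `u, v, z`. -/
def wedge (u v z : E3) : ℝ := |(Matrix.of ![u.ofLp, v.ofLp, z.ofLp]).det|

/-- A tube with unit width (radius `1`), given by a point and a unit direction of its axis.
Different points of the axis describe the same set, so a finite family of tubes in this sense may
contain a geometric tube several times. -/
structure Tube where
  base : E3
  dir : E3
  norm_dir : ‖dir‖ = 1

/-- The set of points at distance at most `1` from the axis. -/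
def Tube.carrier (T : Tube) : Set E3 := {x | ∃ s : ℝ, dist x (T.base + s • T.dir) ≤ 1}

/-- The families `𝒯 0, 𝒯 1, 𝒯 2` are of `(r, j, t, w, m)`-type, where every relation `∼` holds with
the comparability constant `A`. The permutation `σ` is the reordering of the sets `S n`. -/
def IsOfType (A : ℝ) (r j t : ℕ) (w m : E2) (𝒯 : Fin 3 → Finset Tube) : Prop :=
  ‖w‖ = 1 ∧ r ≤ j ∧
  ∃ (S : Fin 3 → Set E3) (θ : ℝ),
    (∀ n, S n ⊆ lift '' {ξ | ‖ξ‖ ≤ 2}) ∧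
    (∀ p₁ ∈ S 0, ∀ p₂ ∈ S 1, ∀ p₃ ∈ S 2,
      Comparable A (wedge (unitNormal p₁) (unitNormal p₂) (unitNormal p₃)) θ) ∧
    (∀ n, ∀ T ∈ 𝒯 n, ∃ p ∈ S n, T.dir = unitNormal p) ∧
    ∃ (σ : Equiv.Perm (Fin 3)) (k k' k'' w' : E2),
      S (σ 0) ⊆ lift '' (square j k ∩ strip (j + t) w m) ∧
      S (σ 1) ⊆ lift '' (square j k' ∩ strip (j + t) w m) ∧
      S (σ 2) ⊆ lift '' (square r k'' ∩ strip (r + t) w' m) ∧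
      m ∈ square j k ∧
      Comparable A (setDist (square j k) (square j k')) ((2 : ℝ) ^ (-(j : ℝ))) ∧
      Comparable A (setDist (square j k') (square r k'')) ((2 : ℝ) ^ (-(r : ℝ))) ∧
      Comparable A (setDist (square j k) (square r k'')) ((2 : ℝ) ^ (-(r : ℝ))) ∧
      ‖w'‖ = 1 ∧
      Comparable A ‖w - w'‖ ((2 : ℝ) ^ (-(t : ℝ))) ∧
      Comparable A θ
        ((2 : ℝ) ^ (-(j : ℝ)) * (2 : ℝ) ^ (-(r : ℝ)) * (2 : ℝ) ^ (-(t : ℝ)))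

end TrilinearKakeya

end

/-!
Near a fixed frequency a tube of the paraboloid is a graph over the vertical axis, with slope minus
the frequency. A Galilean map subtracts a reference frequency of the first family, and a linear map
scales the horizontal plane by `X = 2 ^ j` along `w` and by `X τ = 2 ^ (j + t)` across `w`. Tubes
become slabs of dimensions `X × X τ`; the slopes of the first two families are bounded, those of the
third are `X / ρ = 2 ^ (j - r)` times as large, and after division by that factor the three
reference slopes are transversal. Square roots are subadditive, so at the cost of a constant all
slopes of a family may be assumed to be as close to each other as one likes.

Up to height `X τ` the slabs of the first two families hardly move in one horizontal direction, and
two applications of Cauchy–Schwarz suffice. Beyond that height, covering each slab by unit tubes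
loses nothing, and the argument of Guth for the multilinear Kakeya inequality applies: a frame of
transversal directions is moved to the coordinate axes; tubes with directions near the axes are
cylinders in small balls, where the Loomis–Whitney inequality fattens them to the size of the ball,
and every such change of scale costs a bounded factor, hence at most `R ^ ε` in total when the
scales are far apart. Balls of radius `R < 1` are estimated by their volume when `ε ≤ 3`.
-/

namespace TrilinearKakeya

open scoped ENNReal

universe u

section Integrand

variable {ι κ α β : Type*}

/-- The number of sets `U i`, `i ∈ s`, that contain the point `x`. -/
noncomputable def multiplicity (s : Finset ι) (U : ι → Set α) (x : α) : ℝ≥0∞ :=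
  ∑ i ∈ s, (U i).indicator 1 x

/-- The integrand `∏ n, (∑ i ∈ s n, χ_{U n i})^(1/2)` of the trilinear Kakeya inequality, with
values in `[0, ∞]` so that no integrability has to be carried along. -/
noncomputable def trilinearIntegrand (s : Fin 3 → Finset ι) (U : Fin 3 → ι → Set α) (x : α) :
    ℝ≥0∞ :=
  ∏ n, multiplicity (s n) (U n) x ^ (1 / 2 : ℝ)

/-- The normalization `∏ n, |s n|^(1/2)` of the trilinear Kakeya inequality. -/
noncomputable def sqrtCard (s : Fin 3 → Finset ι) : ℝ≥0∞ :=
  ∏ n, ((s n).card : ℝ≥0∞) ^ (1 / 2 : ℝ)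

lemma multiplicity_eq_card_filter (s : Finset ι) (U : ι → Set α) (x : α)
    [DecidablePred fun i => x ∈ U i] :
    multiplicity s U x = (s.filter fun i => x ∈ U i).card := by
  classical
  simp [multiplicity, Set.indicator_apply]

lemma multiplicity_le_card (s : Finset ι) (U : ι → Set α) (x : α) :
    multiplicity s U x ≤ s.card := by
  classical
  rw [multiplicity_eq_card_filter]
  exact_mod_cast Finset.card_filter_le _ _

lemma multiplicity_le_of_imp {s t : Finset ι} {U : ι → Set α} {V : ι → Set β} {x : α} {y : β}
    (h : ∀ i ∈ s, x ∈ U i → i ∈ t ∧ y ∈ V i) : multiplicity s U x ≤ multiplicity t V y := by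
  classical
  rw [multiplicity_eq_card_filter, multiplicity_eq_card_filter]
  exact_mod_cast Finset.card_le_card fun i hi => by
    simp only [Finset.mem_filter] at hi ⊢
    exact h i hi.1 hi.2

lemma multiplicity_le_of_cover {s : Finset ι} {G : Finset κ} {U : ι → Set α}
    {V : ι × κ → Set β} {x : α} {y : β} (h : ∀ i ∈ s, x ∈ U i → ∃ g ∈ G, y ∈ V (i, g)) :
    multiplicity s U x ≤ multiplicity (s ×ˢ G) V y := by
  classical
  rw [multiplicity_eq_card_filter, multiplicity_eq_card_filter]
  refine Nat.cast_le.2 (Finset.card_le_card_of_surjOn Prod.fst fun i hi => ?_)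
  obtain ⟨hi, hx⟩ := Finset.mem_filter.1 hi
  obtain ⟨g, hg, hy⟩ := h i hi hx
  exact ⟨(i, g), by simp [hi, hg, hy], rfl⟩

lemma multiplicity_mul_multiplicity (s : Finset ι) (t : Finset κ) (U : ι → Set α) (V : κ → Set α)
    (x : α) :
    multiplicity s U x * multiplicity t V x =
      multiplicity (s ×ˢ t) (fun i => U i.1 ∩ V i.2) x := by
  simp only [multiplicity, Finset.sum_mul_sum, Finset.sum_product, Set.inter_indicator_one,
    Pi.mul_apply]

lemma measurable_multiplicity [MeasurableSpace α] {s : Finset ι} {U : ι → Set α}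
    (hU : ∀ i ∈ s, MeasurableSet (U i)) : Measurable (multiplicity s U) :=
  Finset.measurable_fun_sum _ fun i hi => measurable_one.indicator (hU i hi)

lemma lintegral_multiplicity [MeasurableSpace α] (μ : Measure α) {s : Finset ι} {U : ι → Set α}
    (hU : ∀ i ∈ s, MeasurableSet (U i)) : ∫⁻ x, multiplicity s U x ∂μ = ∑ i ∈ s, μ (U i) := by
  simp only [multiplicity]
  rw [lintegral_finsetSum' _ fun i hi => (measurable_one.indicator (hU i hi)).aemeasurable]
  exact Finset.sum_congr rfl fun i hi => lintegral_indicator_one (hU i hi)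

variable {s t : Fin 3 → Finset ι} {U : Fin 3 → ι → Set α} {x : α} {y : β}

lemma measurable_trilinearIntegrand [MeasurableSpace α]
    (hU : ∀ n, ∀ i ∈ s n, MeasurableSet (U n i)) : Measurable (trilinearIntegrand s U) :=
  Finset.measurable_fun_prod _ fun n _ => (measurable_multiplicity (hU n)).pow_const _

lemma trilinearIntegrand_le_sqrtCard (s : Fin 3 → Finset ι) (U : Fin 3 → ι → Set α) (x : α) :
    trilinearIntegrand s U x ≤ sqrtCard s :=
  Finset.prod_le_prod' fun n _ =>
    ENNReal.rpow_le_rpow (multiplicity_le_card (s n) (U n) x) (by norm_num)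

lemma trilinearIntegrand_le_of_imp {V : Fin 3 → ι → Set β}
    (h : ∀ n, ∀ i ∈ s n, x ∈ U n i → i ∈ t n ∧ y ∈ V n i) :
    trilinearIntegrand s U x ≤ trilinearIntegrand t V y :=
  Finset.prod_le_prod' fun n _ =>
    ENNReal.rpow_le_rpow (multiplicity_le_of_imp (h n)) (by norm_num)

lemma trilinearIntegrand_le_of_cover {G : Fin 3 → Finset κ} {V : Fin 3 → ι × κ → Set β}
    (h : ∀ n, ∀ i ∈ s n, x ∈ U n i → ∃ g ∈ G n, y ∈ V n (i, g)) :
    trilinearIntegrand s U x ≤ trilinearIntegrand (fun n => s n ×ˢ G n) V y :=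
  Finset.prod_le_prod' fun n _ =>
    ENNReal.rpow_le_rpow (multiplicity_le_of_cover (h n)) (by norm_num)

lemma sqrtCard_product (s : Fin 3 → Finset ι) (G : Fin 3 → Finset κ) :
    sqrtCard (fun n => s n ×ˢ G n) = sqrtCard s * sqrtCard G := by
  simp only [sqrtCard, Finset.card_product, Nat.cast_mul,
    ENNReal.mul_rpow_of_nonneg _ _ (by norm_num : (0 : ℝ) ≤ 1 / 2), Finset.prod_mul_distrib]

lemma trilinearIntegrand_comp_perm (σ : Equiv.Perm (Fin 3)) (s : Fin 3 → Finset ι)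
    (U : Fin 3 → ι → Set α) (x : α) :
    trilinearIntegrand (s ∘ σ) (U ∘ σ) x = trilinearIntegrand s U x :=
  Equiv.prod_comp σ fun n => multiplicity (s n) (U n) x ^ (1 / 2 : ℝ)

lemma sqrtCard_comp_perm (σ : Equiv.Perm (Fin 3)) (s : Fin 3 → Finset ι) :
    sqrtCard (s ∘ σ) = sqrtCard s :=
  Equiv.prod_comp σ fun n => ((s n).card : ℝ≥0∞) ^ (1 / 2 : ℝ)

open Classical in
lemma sqrtCard_filter_mem (s : Fin 3 → Finset ι) (U : Fin 3 → ι → Set α) (x : α) :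
    sqrtCard (fun n => (s n).filter fun i => x ∈ U n i) = trilinearIntegrand s U x := by
  simp only [sqrtCard, trilinearIntegrand, multiplicity_eq_card_filter]

lemma sqrtCard_mono {s t : Fin 3 → Finset ι} (h : ∀ n, s n ⊆ t n) : sqrtCard s ≤ sqrtCard t :=
  Finset.prod_le_prod' fun n _ =>
    ENNReal.rpow_le_rpow (Nat.cast_le.2 (Finset.card_le_card (h n))) (by norm_num)

lemma lintegral_sqrt_mul_sqrt_le [MeasurableSpace α] (μ : Measure α) {f g : α → ℝ≥0∞}
    (hf : AEMeasurable f μ) (hg : AEMeasurable g μ) :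
    ∫⁻ x, f x ^ (1 / 2 : ℝ) * g x ^ (1 / 2 : ℝ) ∂μ ≤
      (∫⁻ x, f x ∂μ) ^ (1 / 2 : ℝ) * (∫⁻ x, g x ∂μ) ^ (1 / 2 : ℝ) := by
  have sq : ∀ a : ℝ≥0∞, (a ^ (1 / 2 : ℝ)) ^ (2 : ℝ) = a := fun a => by
    rw [← ENNReal.rpow_mul]
    norm_num
  simpa only [sq, Pi.mul_apply] using
    ENNReal.lintegral_mul_le_Lp_mul_Lq μ Real.HolderConjugate.two_two
      (hf.pow_const (1 / 2 : ℝ)) (hg.pow_const (1 / 2 : ℝ))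

lemma lintegral_sqrt_multiplicity_mul_le [MeasurableSpace α] (μ : Measure α) {s t : Finset ι}
    {B C : ι → Set α} {H : ℝ≥0∞} (hB : ∀ i ∈ s, MeasurableSet (B i))
    (hC : ∀ i ∈ t, MeasurableSet (C i)) (hμB : ∀ i ∈ s, μ (B i) ≤ H)
    (hμC : ∀ i ∈ t, μ (C i) ≤ H) :
    ∫⁻ x, multiplicity s B x ^ (1 / 2 : ℝ) * multiplicity t C x ^ (1 / 2 : ℝ) ∂μ ≤
      H * ((s.card : ℝ≥0∞) ^ (1 / 2 : ℝ) * (t.card : ℝ≥0∞) ^ (1 / 2 : ℝ)) := by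
  have hH : H ^ (1 / 2 : ℝ) * H ^ (1 / 2 : ℝ) = H := by
    rw [← ENNReal.rpow_add_of_nonneg _ _ (by norm_num) (by norm_num)]
    norm_num
  calc _ ≤ _ := lintegral_sqrt_mul_sqrt_le μ (measurable_multiplicity hB).aemeasurable
        (measurable_multiplicity hC).aemeasurable
    _ ≤ (s.card * H) ^ (1 / 2 : ℝ) * (t.card * H) ^ (1 / 2 : ℝ) := by
        rw [lintegral_multiplicity μ hB, lintegral_multiplicity μ hC, ← nsmul_eq_mul,
          ← nsmul_eq_mul]
        gcongr
        exacts [Finset.sum_le_card_nsmul _ _ _ hμB, Finset.sum_le_card_nsmul _ _ _ hμC]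
    _ = (H ^ (1 / 2 : ℝ) * H ^ (1 / 2 : ℝ)) *
          ((s.card : ℝ≥0∞) ^ (1 / 2 : ℝ) * (t.card : ℝ≥0∞) ^ (1 / 2 : ℝ)) := by
        simp only [ENNReal.mul_rpow_of_nonneg _ _ (by norm_num : (0 : ℝ) ≤ 1 / 2)]
        ring
    _ = _ := by rw [hH]

variable [MeasurableSpace α] [MeasurableSpace β] {ν : Measure β} {U : Fin 3 → ι → Set (α × β)}
  {B : Fin 3 → ι → Set α} {K K' : ℝ≥0∞}

lemma lintegral_slice_mul_le (hU : ∀ n, ∀ i ∈ s n, MeasurableSet (U n i))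
    (hUB : ∀ n ≠ 2, ∀ i ∈ s n, ∀ x ∈ U n i, x.1 ∈ B n i)
    (hK : ∀ i ∈ s 0, ∀ k ∈ s 1, ∀ q, ν (Prod.mk q ⁻¹' (U 0 i ∩ U 1 k)) ≤ K) (q : α) :
    ∫⁻ y, multiplicity (s 0) (U 0) (q, y) * multiplicity (s 1) (U 1) (q, y) ∂ν ≤
      multiplicity (s 0) (B 0) q * multiplicity (s 1) (B 1) q * K := by
  have hslice : ∀ p ∈ s 0 ×ˢ s 1, MeasurableSet (Prod.mk q ⁻¹' (U 0 p.1 ∩ U 1 p.2)) :=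
    fun p hp => measurable_prodMk_left
      ((hU 0 _ (Finset.mem_product.1 hp).1).inter (hU 1 _ (Finset.mem_product.1 hp).2))
  simp_rw [multiplicity_mul_multiplicity]
  refine (lintegral_multiplicity ν hslice).trans_le ?_
  rw [multiplicity, Finset.sum_mul]
  refine Finset.sum_le_sum fun p hp => ?_
  obtain ⟨hi, hk⟩ := Finset.mem_product.1 hp
  by_cases hq : q ∈ B 0 p.1 ∩ B 1 p.2
  · simpa only [Set.indicator_of_mem hq, Pi.one_apply, one_mul] using hK _ hi _ hk q
  · have hempty : Prod.mk q ⁻¹' (U 0 p.1 ∩ U 1 p.2) = ∅ := Set.eq_empty_of_forall_notMem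
      fun y hy => hq ⟨hUB 0 (by decide) _ hi _ hy.1, hUB 1 (by decide) _ hk _ hy.2⟩
    simp [hempty]

lemma lintegral_slice_le (hU : ∀ i ∈ s 2, MeasurableSet (U 2 i))
    (hK' : ∀ i ∈ s 2, ∀ q, ν (Prod.mk q ⁻¹' U 2 i) ≤ K') (q : α) :
    ∫⁻ y, multiplicity (s 2) (U 2) (q, y) ∂ν ≤ (s 2).card * K' := by
  refine (lintegral_multiplicity ν fun i hi => measurable_prodMk_left (x := q) (hU i hi)).trans_le
    ?_
  rw [← nsmul_eq_mul]
  exact Finset.sum_le_card_nsmul _ _ _ fun i hi => hK' i hi q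

/-- Cauchy–Schwarz in the slice variable decouples the third family from the first two, and a
second Cauchy–Schwarz in the remaining variable decouples these. -/
theorem lintegral_trilinearIntegrand_le_of_slices [SFinite ν] {μ : Measure α} {H : ℝ≥0∞}
    (hU : ∀ n, ∀ i ∈ s n, MeasurableSet (U n i)) (hB : ∀ n, ∀ i ∈ s n, MeasurableSet (B n i))
    (hUB : ∀ n ≠ 2, ∀ i ∈ s n, ∀ x ∈ U n i, x.1 ∈ B n i)
    (hH : ∀ n ≠ 2, ∀ i ∈ s n, μ (B n i) ≤ H)
    (hK : ∀ i ∈ s 0, ∀ k ∈ s 1, ∀ q, ν (Prod.mk q ⁻¹' (U 0 i ∩ U 1 k)) ≤ K)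
    (hK' : ∀ i ∈ s 2, ∀ q, ν (Prod.mk q ⁻¹' U 2 i) ≤ K') :
    ∫⁻ x, trilinearIntegrand s U x ∂(μ.prod ν) ≤ H * (K * K') ^ (1 / 2 : ℝ) * sqrtCard s := by
  have hmeas : ∀ n q, Measurable fun y => multiplicity (s n) (U n) (q, y) := fun n q =>
    (measurable_multiplicity (hU n)).comp measurable_prodMk_left
  have hslice : ∀ q, ∫⁻ y, trilinearIntegrand s U (q, y) ∂ν ≤
      (K * K') ^ (1 / 2 : ℝ) * ((s 2).card : ℝ≥0∞) ^ (1 / 2 : ℝ) *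
        (multiplicity (s 0) (B 0) q ^ (1 / 2 : ℝ) * multiplicity (s 1) (B 1) q ^ (1 / 2 : ℝ)) := by
    intro q
    simp only [trilinearIntegrand, Fin.prod_univ_three,
      ← ENNReal.mul_rpow_of_nonneg _ _ (by norm_num : (0 : ℝ) ≤ 1 / 2)]
    have h := lintegral_sqrt_mul_sqrt_le ν ((hmeas 0 q).fun_mul (hmeas 1 q)).aemeasurable
      (hmeas 2 q).aemeasurable
    grw [lintegral_slice_mul_le hU hUB hK q, lintegral_slice_le (hU 2) hK' q] at h
    simp only [← ENNReal.mul_rpow_of_nonneg _ _ (by norm_num : (0 : ℝ) ≤ 1 / 2)] at h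
    exact h.trans_eq (by ring_nf)
  have hmeasB : ∀ n, Measurable fun q => multiplicity (s n) (B n) q ^ (1 / 2 : ℝ) := fun n =>
    (measurable_multiplicity (hB n)).pow_const _
  rw [lintegral_prod _ (measurable_trilinearIntegrand hU).aemeasurable]
  grw [lintegral_mono hslice, lintegral_const_mul _ ((hmeasB 0).fun_mul (hmeasB 1)),
    lintegral_sqrt_multiplicity_mul_le μ (hB 0) (hB 1) (hH 0 (by decide)) (hH 1 (by decide))]
  simp only [sqrtCard, Fin.prod_univ_three]
  exact le_of_eq (by ring)

end Integrand

section Averaging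

/-- Fubini on `{(x, y) | d(x, y) ≤ s}`. -/
theorem mul_setLIntegral_closedBall_le {α : Type*} [PseudoMetricSpace α]
    [SecondCountableTopology α] [MeasurableSpace α] [OpensMeasurableSpace α] {μ : Measure α}
    [SFinite μ] {f : α → ℝ≥0∞} (hf : Measurable f) {s : ℝ} {v : ℝ≥0∞}
    (hv : ∀ x, μ (Metric.closedBall x s) = v) (c : α) (S : ℝ) :
    v * ∫⁻ x in Metric.closedBall c S, f x ∂μ ≤
      ∫⁻ y in Metric.closedBall c (S + s), ∫⁻ x in Metric.closedBall y s, f x ∂μ ∂μ := by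
  classical
  let k : α → α → ℝ≥0∞ := fun x y => (Metric.closedBall y s).indicator f x
  have hk : Measurable (Function.uncurry k) := by
    have huncurry : Function.uncurry k =
        {z : α × α | dist z.1 z.2 ≤ s}.indicator fun z => f z.1 := by
      ext z
      simp [Function.uncurry, k, Set.indicator_apply]
    rw [huncurry]
    exact (hf.comp measurable_fst).indicator (measurableSet_le measurable_dist measurable_const)
  have hball : ∀ x ∈ Metric.closedBall c S,
      Metric.closedBall x s ⊆ Metric.closedBall c (S + s) := fun x hx =>
    Metric.closedBall_subset_closedBall' (by linarith [Metric.mem_closedBall.1 hx])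
  have hconst : ∀ x ∈ Metric.closedBall c S,
      ∫⁻ y in Metric.closedBall c (S + s), k x y ∂μ = v * f x := by
    intro x hx
    have hsymm : k x = (Metric.closedBall x s).indicator fun _ => f x := by
      ext y
      simp [k, Set.indicator_apply, dist_comm]
    rw [hsymm, lintegral_indicator measurableSet_closedBall, lintegral_const,
      Measure.restrict_restrict measurableSet_closedBall, Measure.restrict_apply_univ,
      Set.inter_eq_left.2 (hball x hx), hv, mul_comm]
  calc v * ∫⁻ x in Metric.closedBall c S, f x ∂μ
      = ∫⁻ x in Metric.closedBall c S, ∫⁻ y in Metric.closedBall c (S + s), k x y ∂μ ∂μ := by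
        rw [← lintegral_const_mul _ hf]
        exact setLIntegral_congr_fun measurableSet_closedBall fun x hx => (hconst x hx).symm
    _ = ∫⁻ y in Metric.closedBall c (S + s), ∫⁻ x in Metric.closedBall c S, k x y ∂μ ∂μ :=
        lintegral_lintegral_swap hk.aemeasurable
    _ ≤ _ := by
        refine lintegral_mono fun y => (setLIntegral_le_lintegral _ _).trans_eq ?_
        exact lintegral_indicator measurableSet_closedBall _

end Averaging

section GraphTube

/-- The neighbourhood of the line `t ↦ P + t V`, a graph over the `n`-th coordinate axis, whose
sections `x n = t` are boxes of half side lengths `W j`. The other two coordinates are indexed by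
`n.succAbove`. -/
def graphTube (n : Fin 3) (W P V : Fin 2 → ℝ) : Set (Fin 3 → ℝ) :=
  {x | ∀ j, |x (n.succAbove j) - (P j + x n * V j)| ≤ W j}

variable {ι : Type*} {s : Fin 3 → Finset ι} {n : Fin 3} {W W' P V : Fin 2 → ℝ} {x y : Fin 3 → ℝ}
  {r : ℝ}

lemma measurableSet_graphTube (n : Fin 3) (W P V : Fin 2 → ℝ) :
    MeasurableSet (graphTube n W P V) := by
  simp only [graphTube, Set.ofPred_forall]
  exact MeasurableSet.iInter fun j => measurableSet_le (by fun_prop) measurable_const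

lemma abs_sub_mul_le_of_dist_le (n : Fin 3) (V : Fin 2 → ℝ) (hxy : dist x y ≤ r) (j : Fin 2) :
    |(x n - y n) * V j| ≤ r * ‖V‖ := by
  rw [abs_mul, ← Real.dist_eq]
  exact mul_le_mul ((dist_le_pi_dist x y n).trans hxy) (norm_le_pi_norm V j) (abs_nonneg _)
    (dist_nonneg.trans hxy)

lemma mem_graphTube_zero_of_dist_le (hx : x ∈ graphTube n W P V) (hxy : dist x y ≤ r)
    (hW : ∀ j, W j + r * ‖V‖ ≤ W' j) : x ∈ graphTube n W' (P + y n • V) 0 := fun j => by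
  simp only [Pi.add_apply, Pi.smul_apply, smul_eq_mul, Pi.zero_apply, mul_zero, add_zero]
  calc _ = |(x (n.succAbove j) - (P j + x n * V j)) + (x n - y n) * V j| := by ring_nf
    _ ≤ W j + r * ‖V‖ :=
        (abs_add_le _ _).trans (add_le_add (hx j) (abs_sub_mul_le_of_dist_le n V hxy j))
    _ ≤ W' j := hW j

lemma mem_graphTube_of_dist_le (hx : x ∈ graphTube n W P V) (hxy : dist x y ≤ r)
    (hW : ∀ j, W j + r + r * ‖V‖ ≤ W' j) : y ∈ graphTube n W' P V := fun j => by
  have hj := (dist_le_pi_dist x y (n.succAbove j)).trans hxy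
  rw [Real.dist_eq] at hj
  have h := mem_graphTube_zero_of_dist_le hx hxy (fun _ => le_rfl) j
  simp only [Pi.add_apply, Pi.smul_apply, smul_eq_mul, Pi.zero_apply, mul_zero, add_zero] at h
  calc _ = |(x (n.succAbove j) - (P j + y n * V j)) - (x (n.succAbove j) - y (n.succAbove j))| := by
        ring_nf
    _ ≤ (W j + r * ‖V‖) + r := (abs_sub _ _).trans (add_le_add h hj)
    _ ≤ W' j := by linarith [hW j]

lemma volume_box {m : Type*} [Fintype m] (c h : m → ℝ) (hh : ∀ i, 0 ≤ h i) :
    volume {y : m → ℝ | ∀ i, |y i - c i| ≤ h i} = ENNReal.ofReal (∏ i, 2 * h i) := by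
  have hset : {y : m → ℝ | ∀ i, |y i - c i| ≤ h i} =
      Set.univ.pi fun i => Metric.closedBall (c i) (h i) := by
    ext y
    simp [Real.dist_eq]
  rw [hset, volume_pi_pi, ENNReal.ofReal_prod_of_nonneg fun i _ => by linarith [hh i]]
  simp only [Real.volume_closedBall]

theorem lintegral_trilinearIntegrand_le_of_coordinate_slices {d : ℕ} (p : Fin (d + 1))
    {U : Fin 3 → ι → Set (Fin (d + 1) → ℝ)} (hU : ∀ n, ∀ i ∈ s n, MeasurableSet (U n i))
    {ζ : Fin 3 → ι → ℝ} {h : ℝ} {K K' : ℝ≥0∞}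
    (hζ : ∀ n ≠ 2, ∀ i ∈ s n, ∀ x ∈ U n i, |x p - ζ n i| ≤ h)
    (hK : ∀ i ∈ s 0, ∀ k ∈ s 1, ∀ q : ℝ, volume (p.insertNth q ⁻¹' (U 0 i ∩ U 1 k)) ≤ K)
    (hK' : ∀ i ∈ s 2, ∀ q : ℝ, volume (p.insertNth q ⁻¹' U 2 i) ≤ K') :
    ∫⁻ x, trilinearIntegrand s U x ≤
      ENNReal.ofReal (2 * h) * (K * K') ^ (1 / 2 : ℝ) * sqrtCard s := by
  set e := (MeasurableEquiv.piFinSuccAbove (fun _ : Fin (d + 1) => ℝ) p).symm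
  have he : MeasurePreserving e :=
    (volume_preserving_piFinSuccAbove (fun _ : Fin (d + 1) => ℝ) p).symm
  rw [← he.lintegral_comp (measurable_trilinearIntegrand hU)]
  refine lintegral_trilinearIntegrand_le_of_slices (U := fun n i => e ⁻¹' U n i)
    (B := fun n i => Metric.closedBall (ζ n i) h)
    (fun n i hi => e.measurable (hU n i hi)) (fun _ _ _ => measurableSet_closedBall) ?_
    (fun n _ i _ => (Real.volume_closedBall _ _).le) hK hK'
  intro n hn i hi x hx
  have hp : e x p = x.1 :=
    Fin.insertNth_apply_same (α := fun _ => ℝ) p x.1 x.2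
  simpa [hp, Real.dist_eq] using hζ n hn i hi _ hx

/-- The Loomis–Whitney inequality for unions of cylinders. -/
theorem lintegral_trilinearIntegrand_cylinder_le (s : Fin 3 → Finset ι)
    (ζ : Fin 3 → ι → Fin 2 → ℝ) {h : ℝ} (hh : 0 ≤ h) :
    ∫⁻ x, trilinearIntegrand s (fun n i => graphTube n (fun _ => h) (ζ n i) 0) x ≤
      ENNReal.ofReal ((2 * h) ^ 3) * sqrtCard s := by
  have hsquare : ∀ c : Fin 2 → ℝ, volume {y : Fin 2 → ℝ | ∀ j, |y j - c j| ≤ h} =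
      ENNReal.ofReal ((2 * h) ^ 2) := fun c => by
    simpa using volume_box c (fun _ => h) fun _ => hh
  refine (lintegral_trilinearIntegrand_le_of_coordinate_slices 2
    (fun _ _ _ => measurableSet_graphTube _ _ _ _) (ζ := fun n i => ζ n i 1) (h := h)
    (K := ENNReal.ofReal ((2 * h) ^ 2)) (K' := ENNReal.ofReal ((2 * h) ^ 2)) ?_ ?_ ?_).trans_eq ?_
  · intro n hn i _ x hx
    have h1 := hx 1
    fin_cases n
    · simpa [Fin.succAbove] using h1
    · simpa [Fin.succAbove] using h1
    · exact absurd rfl hn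
  · intro i _ k _ q
    refine (measure_mono fun y hy => ?_).trans_eq (hsquare ![ζ 1 k 0, ζ 0 i 0])
    have h0 : |y 0 - (ζ 1 k 0 + y 1 * 0)| ≤ h := hy.2 0
    have h1 : |y 1 - (ζ 0 i 0 + y 0 * 0)| ≤ h := hy.1 0
    simp only [mul_zero, add_zero] at h0 h1
    exact Fin.forall_fin_two.2 ⟨h0, h1⟩
  · intro i _ q
    refine (measure_mono fun y hy j => ?_).trans_eq (hsquare (ζ 2 i))
    simpa only [Fin.insertNth_apply_succAbove, Pi.zero_apply, mul_zero, add_zero] using hy j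
  · rw [← pow_two, ← ENNReal.rpow_natCast, ← ENNReal.rpow_mul, Nat.cast_ofNat,
      mul_one_div_cancel two_ne_zero, ENNReal.rpow_one, ← ENNReal.ofReal_mul (by positivity)]
    ring_nf

end GraphTube

section NearAxes

variable {ι : Type*} {s : Fin 3 → Finset ι} {P V : Fin 3 → ι → Fin 2 → ℝ}

/-- In a ball of radius `r` with `r ‖V‖ ≤ W` the tubes are essentially cylinders, and those that
meet the ball contain its centre after fattening. -/
lemma setLIntegral_closedBall_graphTube_le {W W' r δ : ℝ} (hW : 0 ≤ W) (hr : 0 ≤ r)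
    (hrδ : r * δ ≤ W) (hW' : 2 * W + r ≤ W') (hV : ∀ n, ∀ i ∈ s n, ‖V n i‖ ≤ δ)
    (y : Fin 3 → ℝ) :
    ∫⁻ x in Metric.closedBall y r,
        trilinearIntegrand s (fun n i => graphTube n (fun _ => W) (P n i) (V n i)) x ≤
      ENNReal.ofReal ((4 * W) ^ 3) *
        trilinearIntegrand s (fun n i => graphTube n (fun _ => W') (P n i) (V n i)) y := by
  classical
  have hWV : ∀ n, ∀ i ∈ s n, W + r * ‖V n i‖ ≤ 2 * W := fun n i hi => by
    linarith [mul_le_mul_of_nonneg_left (hV n i hi) hr]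
  rw [← sqrtCard_filter_mem, show 4 * W = 2 * (2 * W) by ring]
  refine le_trans ?_ (lintegral_trilinearIntegrand_cylinder_le _ (fun n i => P n i + y n • V n i)
    (by positivity))
  refine (setLIntegral_mono' measurableSet_closedBall fun x hx => ?_).trans
    (setLIntegral_le_lintegral _ _)
  refine trilinearIntegrand_le_of_imp fun n i hi hxi => ⟨Finset.mem_filter.2 ⟨hi, ?_⟩, ?_⟩
  · exact mem_graphTube_of_dist_le hxi hx fun _ => by linarith [hWV n i hi]
  · exact mem_graphTube_zero_of_dist_le hxi hx fun _ => hWV n i hi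

lemma setLIntegral_graphTube_le_fattened {W M : ℝ} (hW : 0 < W) (hM : 1 ≤ M)
    (hV : ∀ n, ∀ i ∈ s n, ‖V n i‖ ≤ M⁻¹) (c : Fin 3 → ℝ) (S : ℝ) :
    ∫⁻ x in Metric.closedBall c S,
        trilinearIntegrand s (fun n i => graphTube n (fun _ => W) (P n i) (V n i)) x ≤
      ENNReal.ofReal ((2 / M) ^ 3) * ∫⁻ x in Metric.closedBall c (S + W * M),
        trilinearIntegrand s (fun n i => graphTube n (fun _ => 3 * W * M) (P n i) (V n i)) x := by
  have : 0 < M := by linarith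
  set v := ENNReal.ofReal ((2 * (W * M)) ^ 3)
  have hv0 : v ≠ 0 := (ENNReal.ofReal_pos.2 (by positivity)).ne'
  have hmeas : ∀ W : ℝ, Measurable
      (trilinearIntegrand s fun n i => graphTube n (fun _ => W) (P n i) (V n i)) := fun _ =>
    measurable_trilinearIntegrand fun _ _ _ => measurableSet_graphTube _ _ _ _
  have hball : ∀ x : Fin 3 → ℝ, volume (Metric.closedBall x (W * M)) = v := fun x => by
    rw [Real.volume_pi_closedBall _ (by positivity), Fintype.card_fin]
  have hconst : v * ENNReal.ofReal ((2 / M) ^ 3) = ENNReal.ofReal ((4 * W) ^ 3) := by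
    rw [← ENNReal.ofReal_mul (by positivity)]
    congr 1
    field_simp
    norm_num
  refine (ENNReal.mul_le_mul_iff_right hv0 ENNReal.ofReal_ne_top).1 ?_
  rw [← mul_assoc, hconst, ← lintegral_const_mul _ (hmeas (3 * W * M))]
  refine (mul_setLIntegral_closedBall_le (hmeas W) hball c S).trans (lintegral_mono fun y => ?_)
  exact setLIntegral_closedBall_graphTube_le (δ := M⁻¹) hW.le (by positivity)
    (by field_simp; rfl) (by nlinarith) hV y

lemma setLIntegral_graphTube_le_pow {M : ℝ} (hM : 1 ≤ M)
    (hV : ∀ n, ∀ i ∈ s n, ‖V n i‖ ≤ M⁻¹) (c : Fin 3 → ℝ) (k : ℕ) :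
    ∀ {W S : ℝ}, 0 < W → S ≤ W * M ^ k →
    ∫⁻ x in Metric.closedBall c S,
        trilinearIntegrand s (fun n i => graphTube n (fun _ => W) (P n i) (V n i)) x ≤
      ENNReal.ofReal (216 ^ k * (4 * W) ^ 3) * sqrtCard s := by
  have : 0 < M := by linarith
  induction k with
  | zero =>
    intro W S hW hS
    have hSM : S ≤ W * M := by nlinarith [pow_zero M]
    refine (lintegral_mono_set (Metric.closedBall_subset_closedBall hSM)).trans
      ((setLIntegral_closedBall_graphTube_le hW.le (by positivity) (δ := M⁻¹)
        (by field_simp; rfl) le_rfl hV c).trans ?_)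
    rw [pow_zero, one_mul]
    gcongr
    exact trilinearIntegrand_le_sqrtCard _ _ _
  | succ k ih =>
    intro W S hW hS
    have hSM : S + W * M ≤ 3 * W * M * M ^ k := by
      have hMk : 1 ≤ M ^ k := one_le_pow₀ hM
      have hWM : 0 < W * M := by positivity
      rw [pow_succ] at hS
      nlinarith
    grw [setLIntegral_graphTube_le_fattened hW hM hV c S, ih (by positivity) hSM, ← mul_assoc,
      ← ENNReal.ofReal_mul (by positivity)]
    refine le_of_eq (congrArg (ENNReal.ofReal · * _) ?_)
    field_simp
    ring

/-- Each change of scale by the factor `M` costs the factor `216`, which is `M ^ ε` for the right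
choice of `M`. -/
theorem exists_setLIntegral_graphTube_le {ε : ℝ} (hε : 0 < ε) :
    ∃ δ : ℝ, 0 < δ ∧ ∀ {ι : Type u} (s : Fin 3 → Finset ι) (P V : Fin 3 → ι → Fin 2 → ℝ),
      (∀ n, ∀ i ∈ s n, ‖V n i‖ ≤ δ) → ∀ (c : Fin 3 → ℝ) (W S : ℝ), 0 < W → W ≤ S →
      ∫⁻ x in Metric.closedBall c S,
          trilinearIntegrand s (fun n i => graphTube n (fun _ => W) (P n i) (V n i)) x ≤
        ENNReal.ofReal (216 * (4 * W) ^ 3 * (S / W) ^ ε) * sqrtCard s := by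
  set M : ℝ := 216 ^ (1 / ε) with hM
  have hM1 : 1 < M := Real.one_lt_rpow (by norm_num) (by positivity)
  have hM0 : 0 < M := by linarith
  have hMε : M ^ ε = 216 := by
    rw [hM, ← Real.rpow_mul (by norm_num), one_div_mul_cancel hε.ne', Real.rpow_one]
  refine ⟨M⁻¹, inv_pos.2 hM0, fun s P V hV c W S hW hS => ?_⟩
  obtain ⟨k, hk, hk'⟩ := exists_nat_pow_near ((one_le_div hW).2 hS) hM1
  refine (setLIntegral_graphTube_le_pow hM1.le hV c (k + 1) hW
    ((div_le_iff₀' hW).1 hk'.le)).trans ?_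
  have hpow : (216 : ℝ) ^ k ≤ (S / W) ^ ε := by
    rw [← hMε, ← Real.rpow_natCast, ← Real.rpow_mul hM0.le, mul_comm, Real.rpow_mul hM0.le,
      Real.rpow_natCast]
    exact Real.rpow_le_rpow (by positivity) hk hε.le
  gcongr ENNReal.ofReal ?_ * _
  calc 216 ^ (k + 1) * (4 * W) ^ 3 = 216 * (4 * W) ^ 3 * 216 ^ k := by ring
    _ ≤ 216 * (4 * W) ^ 3 * (S / W) ^ ε := by gcongr

end NearAxes

section LinearMaps

variable {m : Type*} [Fintype m]

lemma norm_mulVec_le {M : Matrix m m ℝ} {K : ℝ} (hM : ∀ i j, |M i j| ≤ K) (x : m → ℝ) :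
    ‖M.mulVec x‖ ≤ Fintype.card m * K * ‖x‖ := by
  rcases isEmpty_or_nonempty m with h | ⟨⟨i₀⟩⟩
  · simp [Subsingleton.elim (M.mulVec x) 0]
  have hK : 0 ≤ K := (abs_nonneg _).trans (hM i₀ i₀)
  refine (pi_norm_le_iff_of_nonneg (by positivity)).2 fun i => ?_
  calc ‖M.mulVec x i‖ ≤ ∑ j, ‖M i j * x j‖ := norm_sum_le _ _
    _ ≤ ∑ _j : m, K * ‖x‖ := Finset.sum_le_sum fun j _ => by
        rw [norm_mul]
        exact mul_le_mul (hM i j) (norm_le_pi_norm x j) (norm_nonneg _) hK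
    _ = _ := by simp [mul_assoc]

variable [DecidableEq m]

lemma abs_inv_apply_le {M : Matrix m m ℝ} {c C : ℝ} (hc : 0 < c) (hC : 1 ≤ C)
    (hM : ∀ i j, |M i j| ≤ C) (hdet : c ≤ |M.det|) (i j : m) :
    |M⁻¹ i j| ≤ (Fintype.card m).factorial * C ^ Fintype.card m / c := by
  have hadj : |M.adjugate i j| ≤ (Fintype.card m).factorial * C ^ Fintype.card m := by
    rw [Matrix.adjugate_apply, ← nsmul_eq_mul]
    refine Matrix.det_le (abv := AbsoluteValue.abs) fun k l => ?_
    rw [Matrix.updateRow_apply]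
    split_ifs
    · refine le_trans ?_ hC
      rw [Pi.single_apply]
      split_ifs <;> simp
    · exact hM k l
  rw [Matrix.inv_def, Ring.inverse_eq_inv', Matrix.smul_apply, smul_eq_mul, abs_mul, abs_inv,
    inv_mul_eq_div]
  gcongr

lemma setLIntegral_le_of_mulVec {M : Matrix m m ℝ} (hM : M.det ≠ 0) {D D' : Set (m → ℝ)}
    (hD' : MeasurableSet D') {f g : (m → ℝ) → ℝ≥0∞} (hg : Measurable g)
    (h : ∀ x ∈ D, M.mulVec x ∈ D' ∧ f x ≤ g (M.mulVec x)) :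
    ∫⁻ x in D, f x ≤ ENNReal.ofReal |M.det|⁻¹ * ∫⁻ x in D', g x := by
  have hmeas : Measurable (Matrix.toLin' M) := (LinearMap.continuous_on_pi _).measurable
  calc ∫⁻ x in D, f x ≤ ∫⁻ x in D, g (Matrix.toLin' M x) :=
        setLIntegral_mono (hg.comp hmeas) fun x hx => (h x hx).2
    _ ≤ ∫⁻ x in Matrix.toLin' M ⁻¹' D', g (Matrix.toLin' M x) :=
        lintegral_mono_set fun x hx => (h x hx).1
    _ = ∫⁻ x in D', g x ∂(volume.map (Matrix.toLin' M)) := (setLIntegral_map hD' hg hmeas).symm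
    _ = _ := by
        rw [Real.map_matrix_volume_pi_eq_smul_volume_pi hM, Measure.restrict_smul,
          lintegral_smul_measure, abs_inv, smul_eq_mul]

end LinearMaps

section LineTubes

/-- The closed `ρ`-neighbourhood, in the supremum norm, of the line through `P` with direction
`d`. -/
def lineTube (ρ : ℝ) (P d : Fin 3 → ℝ) : Set (Fin 3 → ℝ) :=
  {x | ∃ t : ℝ, ‖x - (P + t • d)‖ ≤ ρ}

/-- The slopes of a line with direction `d`, as a graph over the `n`-th coordinate axis. They are
meaningful for `d n ≠ 0`. -/
noncomputable def slope (n : Fin 3) (d : Fin 3 → ℝ) : Fin 2 → ℝ := fun j => d (n.succAbove j) / d n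

/-- The intercepts of the line through `P` with direction `d`, as a graph over the `n`-th
coordinate axis. -/
noncomputable def intercept (n : Fin 3) (P d : Fin 3 → ℝ) : Fin 2 → ℝ := fun j =>
  P (n.succAbove j) - P n * slope n d j

lemma lineTube_subset_graphTube {n : Fin 3} {ρ v : ℝ} {d : Fin 3 → ℝ} (hd : d n ≠ 0)
    (hv : ‖slope n d‖ ≤ v) (P : Fin 3 → ℝ) :
    lineTube ρ P d ⊆ graphTube n (fun _ => (1 + v) * ρ) (intercept n P d) (slope n d) := by
  rintro x ⟨t, ht⟩ j
  have hr : ∀ k, |x k - (P k + t * d k)| ≤ ρ := fun k => (norm_le_pi_norm _ k).trans ht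
  have hs : |slope n d j| ≤ v := (norm_le_pi_norm (slope n d) j).trans hv
  have hslope : d (n.succAbove j) = slope n d j * d n := (div_mul_cancel₀ _ hd).symm
  calc |x (n.succAbove j) - (intercept n P d j + x n * slope n d j)|
      = |(x (n.succAbove j) - (P (n.succAbove j) + t * d (n.succAbove j))) -
          slope n d j * (x n - (P n + t * d n))| := by
        rw [hslope, intercept]
        ring_nf
    _ ≤ ρ + v * ρ := by
        refine (abs_sub _ _).trans (add_le_add (hr _) ?_)
        rw [abs_mul]
        exact mul_le_mul hs (hr n) (abs_nonneg _) ((abs_nonneg _).trans hs)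
    _ = (1 + v) * ρ := by ring

lemma norm_slope_le_of_norm_sub_single_le {n : Fin 3} {d : Fin 3 → ℝ} {δ : ℝ}
    (hd : ‖d - Pi.single n 1‖ ≤ δ) (hδ : δ ≤ 1 / 2) : d n ≠ 0 ∧ ‖slope n d‖ ≤ 2 * δ := by
  have hn : |d n - 1| ≤ δ := by simpa using (norm_le_pi_norm _ n).trans hd
  have hn2 : 1 / 2 ≤ d n := by linarith [(abs_le.1 hn).1]
  have hδ0 : 0 ≤ δ := (norm_nonneg _).trans hd
  refine ⟨by linarith, (pi_norm_le_iff_of_nonneg (by positivity)).2 fun j => ?_⟩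
  have hj : |d (n.succAbove j)| ≤ δ := by
    simpa [Fin.succAbove_ne] using (norm_le_pi_norm _ (n.succAbove j)).trans hd
  rw [slope, Real.norm_eq_abs, abs_div, abs_of_pos (by linarith : 0 < d n),
    div_le_iff₀ (by linarith)]
  nlinarith

lemma mulVec_mem_lineTube {M : Matrix (Fin 3) (Fin 3) ℝ} {Γ ρ : ℝ} (hΓ : 0 ≤ Γ)
    (hM : ∀ x, ‖M.mulVec x‖ ≤ Γ * ‖x‖) {P d x : Fin 3 → ℝ} (hx : x ∈ lineTube ρ P d) :
    M.mulVec x ∈ lineTube (Γ * ρ) (M.mulVec P) (M.mulVec d) := by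
  obtain ⟨t, ht⟩ := hx
  refine ⟨t, ?_⟩
  rw [← Matrix.mulVec_smul, ← Matrix.mulVec_add, ← Matrix.mulVec_sub]
  exact (hM _).trans (mul_le_mul_of_nonneg_left ht hΓ)

lemma inv_transpose_mulVec_row {F : Matrix (Fin 3) (Fin 3) ℝ} (hF : F.det ≠ 0) (n : Fin 3) :
    (F.transpose⁻¹).mulVec (F n) = Pi.single n 1 := by
  have hrow : F n = F.transpose.mulVec (Pi.single n 1) := by
    rw [Matrix.mulVec_single_one]
    rfl
  rw [hrow, Matrix.mulVec_mulVec, Matrix.nonsing_inv_mul _ (by simpa using hF), Matrix.one_mulVec]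

lemma setLIntegral_lineTube_le_graphTube {ι : Type*} {s : Fin 3 → Finset ι}
    {P d : Fin 3 → ι → Fin 3 → ℝ} {M : Matrix (Fin 3) (Fin 3) ℝ} {Γ δ : ℝ} (hdet : M.det ≠ 0)
    (hΓ : 0 ≤ Γ) (hM : ∀ x, ‖M.mulVec x‖ ≤ Γ * ‖x‖) (hδ : δ ≤ 1 / 2)
    (hd : ∀ n, ∀ i ∈ s n, ‖M.mulVec (d n i) - Pi.single n 1‖ ≤ δ) (x₀ : Fin 3 → ℝ) (S : ℝ) :
    ∫⁻ x in Metric.closedBall x₀ S, trilinearIntegrand s (fun n i => lineTube 1 (P n i) (d n i)) x ≤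
      ENNReal.ofReal |M.det|⁻¹ * ∫⁻ x in Metric.closedBall (M.mulVec x₀) (Γ * S),
        trilinearIntegrand s (fun n i => graphTube n (fun _ => 2 * Γ)
          (intercept n (M.mulVec (P n i)) (M.mulVec (d n i))) (slope n (M.mulVec (d n i)))) x := by
  refine setLIntegral_le_of_mulVec hdet measurableSet_closedBall
    (measurable_trilinearIntegrand fun _ _ _ => measurableSet_graphTube _ _ _ _) fun x hx =>
    ⟨?_, trilinearIntegrand_le_of_imp fun n i hi hxi => ⟨hi, ?_⟩⟩
  · rw [Metric.mem_closedBall, dist_eq_norm] at hx ⊢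
    rw [← Matrix.mulVec_sub]
    exact (hM _).trans (mul_le_mul_of_nonneg_left hx hΓ)
  · obtain ⟨hn, hs⟩ := norm_slope_le_of_norm_sub_single_le (hd n i hi) hδ
    have h := lineTube_subset_graphTube hn (hs.trans (by linarith : 2 * δ ≤ 1)) _
      (mulVec_mem_lineTube hΓ hM hxi)
    rwa [one_add_one_eq_two, mul_one] at h

/-- The inverse transpose of `F` takes the frame, the rows of `F`, to the coordinate axes. -/
theorem exists_setLIntegral_lineTube_le {ε c C : ℝ} (hε : 0 < ε) (hc : 0 < c) (hC : 1 ≤ C) :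
    ∃ η B : ℝ, 0 < η ∧ 0 < B ∧ ∀ {ι : Type u} (s : Fin 3 → Finset ι)
      (P d : Fin 3 → ι → Fin 3 → ℝ) (F : Matrix (Fin 3) (Fin 3) ℝ),
      (∀ n j, |F n j| ≤ C) → c ≤ |F.det| → (∀ n, ∀ i ∈ s n, ‖d n i - F n‖ ≤ η) →
      ∀ (x₀ : Fin 3 → ℝ) (S : ℝ), 1 ≤ S →
      ∫⁻ x in Metric.closedBall x₀ S,
          trilinearIntegrand s (fun n i => lineTube 1 (P n i) (d n i)) x ≤
        ENNReal.ofReal (B * S ^ ε) * sqrtCard s := by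
  obtain ⟨δ, hδ, hkak⟩ := exists_setLIntegral_graphTube_le hε
  set Γ : ℝ := 3 * (6 * C ^ 3 / c)
  have hΓ : 0 < Γ := by positivity
  set δ' := min (1 / 2) (δ / 2)
  have hδ'2 : δ' ≤ 1 / 2 := min_le_left _ _
  have hδ'δ : δ' ≤ δ / 2 := min_le_right _ _
  refine ⟨δ' / Γ, 6 * C ^ 3 * (216 * (4 * (2 * Γ)) ^ 3), by positivity, by positivity,
    fun s P d F hFC hFc hdF x₀ S hS => ?_⟩
  have hF0 : F.det ≠ 0 := abs_pos.1 (hc.trans_le hFc)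
  set M := F.transpose⁻¹
  have hMdet : |M.det|⁻¹ = |F.det| := by
    rw [Matrix.det_nonsing_inv, Matrix.det_transpose, Ring.inverse_eq_inv', abs_inv, inv_inv]
  have hM : ∀ x, ‖M.mulVec x‖ ≤ Γ * ‖x‖ := by
    simpa [Nat.factorial] using norm_mulVec_le (M := M) (abs_inv_apply_le hc hC
      (fun i j => hFC j i) (F.det_transpose.symm ▸ hFc))
  have hdM : ∀ n, ∀ i ∈ s n, ‖M.mulVec (d n i) - Pi.single n 1‖ ≤ δ' := fun n i hi => by
    rw [← inv_transpose_mulVec_row hF0, ← Matrix.mulVec_sub]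
    exact (hM _).trans ((le_div_iff₀' hΓ).1 (hdF n i hi))
  have hFdet : |F.det| ≤ 6 * C ^ 3 := by
    simpa [Nat.factorial] using Matrix.det_le (abv := AbsoluteValue.abs) hFC
  have hball : Γ * S ≤ 2 * Γ * S := by nlinarith
  have hnear := hkak s (fun n i => intercept n (M.mulVec (P n i)) (M.mulVec (d n i)))
    (fun n i => slope n (M.mulVec (d n i)))
    (fun n i hi => (norm_slope_le_of_norm_sub_single_le (hdM n i hi) hδ'2).2.trans (by linarith))
    (M.mulVec x₀) (2 * Γ) (2 * Γ * S) (by positivity) (by nlinarith)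
  rw [mul_div_cancel_left₀ _ (by positivity)] at hnear
  grw [setLIntegral_lineTube_le_graphTube (by simpa [M] using hF0) hΓ.le hM hδ'2 hdM,
    lintegral_mono_set (Metric.closedBall_subset_closedBall hball), hnear, hMdet, hFdet,
    ← mul_assoc, ← ENNReal.ofReal_mul (by positivity), ← mul_assoc]

end LineTubes

section Covering

/-- The integer points of (a slight enlargement of) the box `∏ j, [-B j, B j]`. -/
noncomputable def boxGrid (B : Fin 3 → ℝ) : Finset (Fin 3 → ℤ) :=
  Fintype.piFinset fun j => Finset.Icc (-⌈B j⌉) ⌈B j⌉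

lemma card_boxGrid_le {B : Fin 3 → ℝ} (hB : ∀ j, 0 ≤ B j) :
    ((boxGrid B).card : ℝ) ≤ ∏ j, (2 * B j + 3) := by
  rw [boxGrid, Fintype.card_piFinset, Nat.cast_prod]
  refine Finset.prod_le_prod (fun _ _ => Nat.cast_nonneg _) fun j _ => ?_
  have hceil : (0 : ℤ) ≤ ⌈B j⌉ := Int.ceil_nonneg (hB j)
  rw [Int.card_Icc, ← Int.cast_natCast, Int.toNat_of_nonneg (by omega)]
  push_cast
  linarith [Int.ceil_lt_add_one (B j)]

lemma exists_mem_boxGrid_mem_lineTube {B b d x : Fin 3 → ℝ} {t : ℝ}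
    (h : ∀ j, |x j - (b j + t * d j)| ≤ B j) :
    ∃ g ∈ boxGrid B, x ∈ lineTube 1 (b + fun j => (g j : ℝ)) d := by
  set y : Fin 3 → ℝ := fun j => x j - (b j + t * d j)
  refine ⟨fun j => ⌊y j⌋, Fintype.mem_piFinset.2 fun j => Finset.mem_Icc.2 ⟨?_, ?_⟩, t,
    (pi_norm_le_iff_of_nonneg zero_le_one).2 fun j => ?_⟩
  · rw [Int.le_floor, Int.cast_neg]
    linarith [(abs_le.1 (h j)).1, Int.le_ceil (B j)]
  · exact Int.cast_le.1 ((Int.floor_le _).trans ((le_abs_self _).trans ((h j).trans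
      (Int.le_ceil _))))
  · have hfract : (x - (b + (fun j => (⌊y j⌋ : ℝ)) + t • d)) j = Int.fract (y j) := by
      simp only [Pi.sub_apply, Pi.add_apply, Pi.smul_apply, smul_eq_mul, Int.fract, y]
      ring
    rw [hfract, Real.norm_eq_abs, Int.abs_fract]
    exact (Int.fract_lt_one _).le

variable {W P V : Fin 2 → ℝ} {x : Fin 3 → ℝ} {c C H σ : ℝ}

lemma exists_mem_boxGrid_of_mem_graphTube (hx : x ∈ graphTube 2 W P V) :
    ∃ g ∈ boxGrid ![W 0, W 1, 0],
      x ∈ lineTube 1 (![P 0, P 1, 0] + fun j => (g j : ℝ)) ![V 0, V 1, 1] := by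
  refine exists_mem_boxGrid_mem_lineTube (t := x 2) fun j => ?_
  fin_cases j
  · exact hx 0
  · exact hx 1
  · simp

/-- The half side lengths of a box that is degenerate in the `k`-th of the two horizontal
directions; the other horizontal one is `L` and the vertical one is `h`. -/
def steepBox (k : Fin 2) (L h : ℝ) : Fin 3 → ℝ :=
  ![if k = 0 then 0 else L, if k = 1 then 0 else L, h]

lemma prod_steepBox (k : Fin 2) (L h : ℝ) :
    ∏ j, (2 * steepBox k L h j + 3) = 3 * (2 * L + 3) * (2 * h + 3) := by
  simp only [steepBox, Fin.prod_univ_three, Matrix.cons_val]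
  fin_cases k
  · norm_num
  · norm_num [mul_comm]

/-- The point of the axis with the same `k`-th coordinate as `x` has a height that differs from
`x 2` by much less than `W k` when the tube is steep. -/
lemma exists_mem_boxGrid_of_mem_graphTube_smul (hc : 0 < c) (hσ : 0 < σ) (hW : ∀ j, W j ≤ H)
    (k : Fin 2) (hV : c ≤ |V k|) (hVC : ∀ j, |V j| ≤ C) (hx : x ∈ graphTube 2 W P (σ • V)) :
    ∃ g ∈ boxGrid (steepBox k ((1 + C / c) * H) (W k / (c * σ))),
      x ∈ lineTube 1 (![P 0, P 1, 0] + fun j => (g j : ℝ)) ![V 0, V 1, σ⁻¹] := by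
  set y : Fin 2 → ℝ := fun j => x (Fin.succAbove 2 j) - (P j + x 2 * (σ * V j))
  have hy : ∀ j, |y j| ≤ W j := hx
  have hV0 : V k ≠ 0 := abs_pos.1 (hc.trans_le hV)
  have hlam : |y k / V k| ≤ W k / c := by
    rw [abs_div]
    exact div_le_div₀ ((abs_nonneg _).trans (hy k)) (hy k) hc hV
  have hcoord : ∀ j, |x (Fin.succAbove 2 j) - (P j + (σ * x 2 + y k / V k) * V j)| ≤
      if k = j then 0 else (1 + C / c) * H := by
    intro j
    rw [show x (Fin.succAbove 2 j) - (P j + (σ * x 2 + y k / V k) * V j) =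
      y j - y k / V k * V j by simp only [y]; ring]
    split_ifs with hkj
    · rw [← hkj, div_mul_cancel₀ _ hV0, sub_self, abs_zero]
    · calc |y j - y k / V k * V j| ≤ |y j| + |y k / V k| * |V j| := by
            rw [← abs_mul]
            exact abs_sub _ _
        _ ≤ H + H / c * C := by
            have hH : 0 ≤ H := (abs_nonneg _).trans ((hy k).trans (hW k))
            gcongr
            · exact (hy j).trans (hW j)
            · exact hlam.trans (by gcongr; exact hW k)
            · exact hVC j
        _ = (1 + C / c) * H := by ring
  refine exists_mem_boxGrid_mem_lineTube (t := σ * x 2 + y k / V k) fun j => ?_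
  fin_cases j
  · exact hcoord 0
  · exact hcoord 1
  · have hheight : x 2 - (0 + (σ * x 2 + y k / V k) * σ⁻¹) = -(y k / V k / σ) := by
      field_simp
      ring
    change |x 2 - (0 + (σ * x 2 + y k / V k) * σ⁻¹)| ≤ W k / (c * σ)
    rw [hheight, abs_neg, abs_div, abs_of_pos hσ, ← div_div]
    gcongr

/-- The oriented area of the parallelogram spanned by two plane vectors. -/
def cross (ξ ζ : Fin 2 → ℝ) : ℝ := ξ 0 * ζ 1 - ξ 1 * ζ 0

lemma sqrtCard_le_ofReal_sqrt {κ : Type*} {G : Fin 3 → Finset κ} {N : Fin 3 → ℝ}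
    (h : ∀ n, ((G n).card : ℝ) ≤ N n) : sqrtCard G ≤ ENNReal.ofReal √(∏ n, N n) := by
  have hN : ∀ n, 0 ≤ N n := fun n => (Nat.cast_nonneg _).trans (h n)
  rw [Real.sqrt_eq_rpow, ← Real.finsetProd_rpow _ _ fun n _ => hN n,
    ENNReal.ofReal_prod_of_nonneg fun n _ => Real.rpow_nonneg (hN n) _]
  refine Finset.prod_le_prod' fun n _ => ?_
  rw [← ENNReal.ofReal_rpow_of_nonneg (hN n) (by norm_num)]
  gcongr
  rw [← ENNReal.ofReal_natCast]
  exact ENNReal.ofReal_le_ofReal (h n)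

/-- The translations of unit tubes that cover a slab, for the three families of slabs. The slabs of
the last family have a slope of size at least `c σ` in the `k`-th direction. -/
noncomputable def slabGrid (W : Fin 2 → ℝ) (c C H σ : ℝ) (k : Fin 2) :
    Fin 3 → Finset (Fin 3 → ℤ) :=
  ![boxGrid ![W 0, W 1, 0], boxGrid ![W 0, W 1, 0],
    boxGrid (steepBox k ((1 + C / c) * H) (W k / (c * σ)))]

lemma trilinearIntegrand_slab_le_lineTube {ι : Type*} {s : Fin 3 → Finset ι}
    {P V : Fin 3 → ι → Fin 2 → ℝ} (hc : 0 < c) (hσ : 0 < σ) (hW : ∀ j, W j ≤ H) (k : Fin 2)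
    (hV : ∀ i ∈ s 2, c ≤ |V 2 i k|) (hVC : ∀ i ∈ s 2, ∀ j, |V 2 i j| ≤ C) (x : Fin 3 → ℝ) :
    trilinearIntegrand s (fun n i => graphTube 2 W (P n i) ((![1, 1, σ] n : ℝ) • V n i)) x ≤
      trilinearIntegrand (fun n => s n ×ˢ slabGrid W c C H σ k n)
        (fun n i => lineTube 1 (![P n i.1 0, P n i.1 1, 0] + fun j => (i.2 j : ℝ))
          ![V n i.1 0, V n i.1 1, (![1, 1, σ⁻¹] : Fin 3 → ℝ) n]) x := by
  refine trilinearIntegrand_le_of_cover fun n i hi hx => ?_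
  match n with
  | 0 | 1 =>
    simp only [slabGrid, Matrix.cons_val, one_smul] at hx ⊢
    exact exists_mem_boxGrid_of_mem_graphTube hx
  | 2 =>
    simp only [slabGrid, Matrix.cons_val] at hx ⊢
    exact exists_mem_boxGrid_of_mem_graphTube_smul hc hσ hW k (hV i hi) (hVC i hi) hx

lemma sqrtCard_slabGrid_le (hc : 0 < c) (hC : 0 ≤ C) (hσ : 0 < σ) (hH : 1 ≤ H)
    (hW : ∀ j, 1 ≤ W j) (k : Fin 2) :
    sqrtCard (slabGrid W c C H σ k) ≤
      ENNReal.ofReal (75 * √(15 * (1 + C / c) * (3 + 2 / c)) *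
        (W 0 * W 1 * √(H * (1 + W k / σ)))) := by
  have hW0 : ∀ j, 0 < W j := fun j => one_pos.trans_le (hW j)
  have hWσ : 0 < W k / σ := div_pos (hW0 k) hσ
  have hflat : ((boxGrid ![W 0, W 1, 0]).card : ℝ) ≤ 75 * (W 0 * W 1) := by
    refine (card_boxGrid_le (Fin.forall_fin_succ.2 ⟨(hW0 0).le, ?_⟩)).trans ?_
    · simpa [Fin.forall_fin_two] using (hW0 1).le
    · simp only [Fin.prod_univ_three, Matrix.cons_val]
      nlinarith [hW 0, hW 1]
  have hsteep : ((boxGrid (steepBox k ((1 + C / c) * H) (W k / (c * σ)))).card : ℝ) ≤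
      15 * (1 + C / c) * (3 + 2 / c) * (H * (1 + W k / σ)) := by
    have hL : 1 ≤ (1 + C / c) * H := one_le_mul_of_one_le_of_one_le
      (le_add_of_nonneg_right (by positivity)) hH
    have hh : 2 * (W k / (c * σ)) + 3 ≤ (3 + 2 / c) * (1 + W k / σ) := by
      have hsplit : W k / (c * σ) = c⁻¹ * (W k / σ) := by field_simp
      rw [hsplit, div_eq_mul_inv 2 c]
      nlinarith [inv_pos.2 hc]
    refine (card_boxGrid_le fun j => ?_).trans ((prod_steepBox k _ _).trans_le ?_)
    · have := hW0 k
      fin_cases j <;> dsimp [steepBox] <;> positivity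
    · have := hW0 k
      calc 3 * (2 * ((1 + C / c) * H) + 3) * (2 * (W k / (c * σ)) + 3)
          ≤ 3 * (5 * ((1 + C / c) * H)) * ((3 + 2 / c) * (1 + W k / σ)) := by
            gcongr
            linarith
        _ = _ := by ring
  refine (sqrtCard_le_ofReal_sqrt (N := ![75 * (W 0 * W 1), 75 * (W 0 * W 1),
    15 * (1 + C / c) * (3 + 2 / c) * (H * (1 + W k / σ))]) ?_).trans (le_of_eq ?_)
  · simpa [Fin.forall_fin_succ, slabGrid] using ⟨hflat, hsteep⟩
  · have := (hW0 0).le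
    have := (hW0 1).le
    simp only [Fin.prod_univ_three, Matrix.cons_val]
    rw [← sq, Real.sqrt_mul (by positivity), Real.sqrt_sq (by positivity),
      Real.sqrt_mul (by positivity)]
    ring_nf

/-- The slabs of the last family move `σ` times faster, so that in the direction `(a 2, σ⁻¹)` they
become tubes. -/
theorem exists_setLIntegral_slab_le_of_covering {ε c C : ℝ} (hε : 0 < ε) (hc : 0 < c)
    (hC : 1 ≤ C) :
    ∃ η B : ℝ, 0 < η ∧ 0 < B ∧ ∀ {ι : Type u} (s : Fin 3 → Finset ι) (P V : Fin 3 → ι → Fin 2 → ℝ)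
      (a : Fin 3 → Fin 2 → ℝ) {W : Fin 2 → ℝ} {H σ : ℝ} (k : Fin 2),
      a 0 = 0 → (∀ n j, |a n j| ≤ C) → c ≤ |cross (a 1) (a 2)| → c ≤ |a 2 k| → 1 ≤ σ →
      (∀ j, 1 ≤ W j) → (∀ j, W j ≤ H) → (∀ n, ∀ i ∈ s n, ‖V n i - a n‖ ≤ η) →
      ∀ (x₀ : Fin 3 → ℝ) (S : ℝ), 1 ≤ S →
      ∫⁻ x in Metric.closedBall x₀ S,
          trilinearIntegrand s (fun n i => graphTube 2 W (P n i) ((![1, 1, σ] n : ℝ) • V n i)) x ≤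
        ENNReal.ofReal (B * S ^ ε * (W 0 * W 1 * √(H * (1 + W k / σ)))) * sqrtCard s := by
  obtain ⟨η, B, hη, hB, hkak⟩ := exists_setLIntegral_lineTube_le hε hc hC
  set K := 75 * √(15 * (1 + 2 * C / (c / 2)) * (3 + 2 / (c / 2)))
  refine ⟨min η (min (c / 2) C), B * K, by positivity, by positivity,
    fun {ι} s P V a W H σ k ha0 haC hdet hak hσ hW hWH hVa x₀ S hS => ?_⟩
  have hσ0 : 0 < σ := by linarith
  have hVa' : ∀ n, ∀ i ∈ s n, ∀ j, |V n i j - a n j| ≤ min η (min (c / 2) C) :=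
    fun n i hi j => (norm_le_pi_norm (V n i - a n) j).trans (hVa n i hi)
  have hlines := hkak (fun n => s n ×ˢ slabGrid W (c / 2) (2 * C) H σ k n)
    (fun n i => ![P n i.1 0, P n i.1 1, 0] + fun j => (i.2 j : ℝ))
    (fun n i => ![V n i.1 0, V n i.1 1, (![1, 1, σ⁻¹] : Fin 3 → ℝ) n])
    (Matrix.of fun n => ![a n 0, a n 1, (![1, 1, σ⁻¹] : Fin 3 → ℝ) n])
    ?entries ?det ?dir x₀ S hS
  case entries =>
    have hσ1 : |σ|⁻¹ ≤ C := by
      rw [abs_of_pos hσ0]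
      exact (inv_le_one_of_one_le₀ hσ).trans hC
    simp only [Fin.forall_fin_succ, Matrix.of_apply]
    simp [haC, hσ1, hC]
  case det =>
    rw [Matrix.det_fin_three]
    simpa [ha0, cross, abs_sub_comm] using hdet
  case dir =>
    intro n i hi
    have h := hVa' n i.1 (Finset.mem_product.1 hi).1
    rw [pi_norm_le_iff_of_nonneg hη.le]
    simpa [Fin.forall_fin_succ, hη.le] using And.intro ((h 0).trans (min_le_left _ _))
      ((h 1).trans (min_le_left _ _))
  have hcover := trilinearIntegrand_slab_le_lineTube (P := P) (half_pos hc) hσ0 hWH k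
    (V := V) (s := s) (C := 2 * C) ?_ ?_
  · grw [lintegral_mono hcover, hlines, sqrtCard_product,
      sqrtCard_slabGrid_le (half_pos hc) (by positivity) hσ0 ((hW 0).trans (hWH 0)) hW k,
      mul_comm (sqrtCard s), ← mul_assoc, ← ENNReal.ofReal_mul (by positivity)]
    refine le_of_eq (congrArg (ENNReal.ofReal · * _) ?_)
    ring
  · intro i hi
    have h := (hVa' 2 i hi k).trans ((min_le_right _ _).trans (min_le_left _ _))
    rw [abs_sub_comm] at h
    linarith [abs_sub_abs_le_abs_sub (a 2 k) (V 2 i k)]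
  · intro i hi j
    have h := (hVa' 2 i hi j).trans ((min_le_right _ _).trans (min_le_right _ _))
    linarith [abs_sub_abs_le_abs_sub (V 2 i j) (a 2 j), haC 2 j]

end Covering

section Planar

lemma volume_parallelepiped_le {m : Type*} [Fintype m] [DecidableEq m] {N : Matrix m m ℝ}
    {κ : ℝ} (hκ : 0 < κ) (hN : κ ≤ |N.det|) (p : m → ℝ) {h : m → ℝ} (hh : ∀ i, 0 ≤ h i) :
    volume {z : m → ℝ | ∀ i, |N.mulVec z i - p i| ≤ h i} ≤
      ENNReal.ofReal ((∏ i, 2 * h i) / κ) := by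
  have hN0 : LinearMap.det (Matrix.toLin' N) ≠ 0 := by
    rw [LinearMap.det_toLin']
    exact abs_pos.1 (hκ.trans_le hN)
  have hpre := Measure.addHaar_preimage_linearMap volume hN0 {y | ∀ i, |y i - p i| ≤ h i}
  rw [LinearMap.det_toLin', volume_box p h hh, abs_inv, ← ENNReal.ofReal_mul (by positivity),
    inv_mul_eq_div] at hpre
  refine hpre.trans_le (ENNReal.ofReal_le_ofReal ?_)
  have hprod : 0 ≤ ∏ i, 2 * h i := Finset.prod_nonneg fun i _ => mul_nonneg zero_le_two (hh i)
  gcongr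

lemma abs_cross_le {ξ ζ : Fin 2 → ℝ} {b b' : ℝ} (hξ : ∀ j, |ξ j| ≤ b) (hζ : ∀ j, |ζ j| ≤ b') :
    |cross ξ ζ| ≤ 2 * (b * b') := by
  have hb : 0 ≤ b := (abs_nonneg _).trans (hξ 0)
  calc |cross ξ ζ| ≤ |ξ 0| * |ζ 1| + |ξ 1| * |ζ 0| := by
        rw [← abs_mul, ← abs_mul]
        exact abs_sub _ _
    _ ≤ b * b' + b * b' := by
        gcongr
        exacts [hξ 0, hζ 1, hξ 1, hζ 0]
    _ = 2 * (b * b') := by ring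

lemma cross_sub (a ξ ζ : Fin 2 → ℝ) : cross a (ξ - ζ) = cross a ξ - cross a ζ := by
  simp only [cross, Pi.sub_apply]
  ring

lemma cross_smul (a : Fin 2 → ℝ) (t : ℝ) (ξ : Fin 2 → ℝ) : cross a (t • ξ) = t * cross a ξ := by
  simp only [cross, Pi.smul_apply, smul_eq_mul]
  ring

/-- The coordinates `cross a (x 0, x 1)`, `x k` and `x 2`. -/
def planarCoords (a : Fin 2 → ℝ) (k : Fin 2) : Matrix (Fin 3) (Fin 3) ℝ :=
  Matrix.of ![![-a 1, a 0, 0], Pi.single k.castSucc 1, Pi.single 2 1]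

lemma abs_det_planarCoords (a : Fin 2 → ℝ) (k : Fin 2) : |(planarCoords a k).det| = |a k| := by
  rw [Matrix.det_fin_three]
  fin_cases k <;> simp [planarCoords]

lemma planarCoords_mulVec (a : Fin 2 → ℝ) (k : Fin 2) (x : Fin 3 → ℝ) :
    (planarCoords a k).mulVec x = ![cross a fun j => x j.castSucc, x k.castSucc, x 2] := by
  funext i
  fin_cases i
  · change ∑ l, ![-a 1, a 0, 0] l * x l = a 0 * x 1 - a 1 * x 0
    simp only [Fin.sum_univ_three, Matrix.cons_val]
    ring
  · simp [planarCoords, Matrix.mulVec]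
  · simp [planarCoords, Matrix.mulVec]

lemma abs_cross_sub_le_of_mem_graphTube {W a P V : Fin 2 → ℝ} {C H : ℝ} {x : Fin 3 → ℝ}
    (hW : ∀ j, W j ≤ H) (ha : ∀ j, |a j| ≤ C) (hx : x ∈ graphTube 2 W P V) :
    |cross a (fun j => x j.castSucc) - (cross a P + x 2 * cross a V)| ≤ 2 * (C * H) := by
  have hcross := abs_cross_le ha fun j => (hx j).trans (hW j)
  refine le_of_eq_of_le (congrArg _ ?_) hcross
  simp only [cross]
  change _ = a 0 * (x 1 - (P 1 + x 2 * V 1)) - a 1 * (x 0 - (P 0 + x 2 * V 0))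
  change a 0 * x 1 - a 1 * x 0 - _ = _
  ring

/-- The coordinates `planarCoords a k` of the points of a slab at heights in `[z - R, z + R]`. -/
def planarSlab (a : Fin 2 → ℝ) (k : Fin 2) (w L z R : ℝ) (P V : Fin 2 → ℝ) : Set (Fin 3 → ℝ) :=
  {y | |y 0 - (cross a P + y 2 * cross a V)| ≤ L ∧ |y 1 - (P k + y 2 * V k)| ≤ w ∧ |y 2 - z| ≤ R}

variable {a P V P' V' : Fin 2 → ℝ} {k : Fin 2} {w L z R κ : ℝ}

lemma measurableSet_planarSlab : MeasurableSet (planarSlab a k w L z R P V) := by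
  have h : ∀ {f : (Fin 3 → ℝ) → ℝ} {c : ℝ}, Measurable f → MeasurableSet {y | |f y| ≤ c} :=
    fun hf => measurableSet_le (by fun_prop) measurable_const
  exact (h (by fun_prop)).inter ((h (by fun_prop)).inter (h (by fun_prop)))

lemma abs_sub_le_of_mem_planarSlab {C : ℝ} (ha : ∀ j, |a j| ≤ C) (hV : ∀ j, |V j| ≤ C)
    {y : Fin 3 → ℝ} (hy : y ∈ planarSlab a k w L z R P V) :
    |y 0 - (cross a P + z * cross a V)| ≤ L + R * (2 * (C * C)) := by
  have hR : 0 ≤ R := (abs_nonneg _).trans hy.2.2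
  calc |y 0 - (cross a P + z * cross a V)|
      = |(y 0 - (cross a P + y 2 * cross a V)) + (y 2 - z) * cross a V| := by ring_nf
    _ ≤ |y 0 - (cross a P + y 2 * cross a V)| + |y 2 - z| * |cross a V| := by
        rw [← abs_mul]
        exact abs_add_le _ _
    _ ≤ L + R * (2 * (C * C)) := by
        gcongr
        exacts [hy.1, hy.2.2, abs_cross_le ha hV]

lemma volume_slice_planarSlab_inter_le (hw : 0 ≤ w) (hκ : 0 < κ) (hV : κ ≤ |V' k - V k|) (q : ℝ) :
    volume ((0 : Fin 3).insertNth q ⁻¹'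
        (planarSlab a k w L z R P V ∩ planarSlab a k w L z R P' V')) ≤
      ENNReal.ofReal (4 * w ^ 2 / κ) := by
  have hdet : κ ≤ |(!![1, -V k; 1, -V' k] : Matrix (Fin 2) (Fin 2) ℝ).det| := by
    rw [Matrix.det_fin_two_of, ← abs_neg]
    ring_nf at hV ⊢
    exact hV
  refine (measure_mono fun y hy => ?_).trans
    ((volume_parallelepiped_le hκ hdet ![P k, P' k] (h := fun _ => w) fun _ => hw).trans_eq ?_)
  · have h₀ : |y 0 - (P k + y 1 * V k)| ≤ w := hy.1.2.1
    have h₁ : |y 0 - (P' k + y 1 * V' k)| ≤ w := hy.2.2.1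
    simp only [Set.mem_ofPred_eq, Fin.forall_fin_two, Matrix.mulVec, dotProduct,
      Fin.sum_univ_two, Matrix.of_apply, Matrix.cons_val]
    ring_nf at h₀ h₁ ⊢
    exact ⟨h₀, h₁⟩
  · rw [Fin.prod_univ_two]
    ring_nf

lemma volume_slice_planarSlab_le (hw : 0 ≤ w) (hL : 0 ≤ L) (hκ : 0 < κ) (hV : κ ≤ |cross a V|)
    (q : ℝ) :
    volume ((0 : Fin 3).insertNth q ⁻¹' planarSlab a k w L z R P V) ≤
      ENNReal.ofReal (4 * (w * L) / κ) := by
  have hdet : κ ≤ |(!![1, -V k; 0, cross a V] : Matrix (Fin 2) (Fin 2) ℝ).det| := by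
    rw [Matrix.det_fin_two_of]
    ring_nf
    exact hV
  refine (measure_mono fun y hy => ?_).trans
    ((volume_parallelepiped_le hκ hdet ![P k, q - cross a P] (h := ![w, L]) ?_).trans_eq ?_)
  · have h₀ : |y 0 - (P k + y 1 * V k)| ≤ w := hy.2.1
    have h₁ : |q - (cross a P + y 1 * cross a V)| ≤ L := hy.1
    rw [abs_sub_comm] at h₁
    simp only [Set.mem_ofPred_eq, Fin.forall_fin_two, Matrix.mulVec, dotProduct,
      Fin.sum_univ_two, Matrix.of_apply, Matrix.cons_val]
    ring_nf at h₀ h₁ ⊢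
    exact ⟨h₀, h₁⟩
  · exact Fin.forall_fin_two.2 ⟨hw, hL⟩
  · rw [Fin.prod_univ_two]
    simp only [Matrix.cons_val]
    ring_nf

/-- On a slab of height at most `H` the first two families are almost constant in the direction
transversal to `a`, so that only two dimensional transversality is needed. -/
theorem setLIntegral_slab_le_of_planar {ι : Type*} {s : Fin 3 → Finset ι}
    {P V : Fin 3 → ι → Fin 2 → ℝ} {W a : Fin 2 → ℝ} {C H R κ κ' : ℝ} (k : Fin 2)
    (hWk : 0 ≤ W k) (hW : ∀ j, W j ≤ H) (hC : 1 ≤ C) (hR : 0 ≤ R) (hRH : R ≤ H) (hκ : 0 < κ)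
    (hκ' : 0 < κ') (hak : a k ≠ 0) (ha : ∀ j, |a j| ≤ C)
    (hVC : ∀ n ≠ 2, ∀ i ∈ s n, ∀ j, |V n i j| ≤ C)
    (hV : ∀ i ∈ s 0, ∀ i' ∈ s 1, κ ≤ |V 1 i' k - V 0 i k|)
    (hV₂ : ∀ i ∈ s 2, κ' ≤ |cross a (V 2 i)|) (z : ℝ) :
    ∫⁻ x in {x | |x 2 - z| ≤ R}, trilinearIntegrand s (fun n i => graphTube 2 W (P n i) (V n i)) x ≤
      ENNReal.ofReal (|a k|⁻¹ * (8 * C ^ 2 * H) *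
        √(4 * W k ^ 2 / κ * (4 * (W k * (2 * (C * H))) / κ'))) * sqrtCard s := by
  have hH : 0 ≤ H := hR.trans hRH
  have hC0 : 0 ≤ C := zero_le_one.trans hC
  have hmeas : ∀ n, ∀ i ∈ s n,
      MeasurableSet (planarSlab a k (W k) (2 * (C * H)) z R (P n i) (V n i)) :=
    fun _ _ _ => measurableSet_planarSlab
  have hslices := lintegral_trilinearIntegrand_le_of_coordinate_slices 0 hmeas
    (ζ := fun n i => cross a (P n i) + z * cross a (V n i)) (h := 4 * C ^ 2 * H) ?_
    (fun i hi i' hi' => volume_slice_planarSlab_inter_le hWk hκ (hV i hi i' hi'))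
    (fun i hi => volume_slice_planarSlab_le hWk (by positivity) hκ' (hV₂ i hi))
  · grw [setLIntegral_le_of_mulVec (abs_pos.1 (by rwa [abs_det_planarCoords, abs_pos]))
      MeasurableSet.univ (measurable_trilinearIntegrand hmeas) ?_, setLIntegral_univ, hslices,
      abs_det_planarCoords, ← ENNReal.ofReal_mul (by positivity),
      ENNReal.ofReal_rpow_of_nonneg (by positivity) (by norm_num), ← Real.sqrt_eq_rpow,
      ← mul_assoc, ← mul_assoc, ← ENNReal.ofReal_mul (by positivity),
      ← ENNReal.ofReal_mul (by positivity)]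
    · refine le_of_eq (congrArg (ENNReal.ofReal · * _) ?_)
      ring
    · refine fun x hx => ⟨trivial, trilinearIntegrand_le_of_imp fun n i hi hxi => ⟨hi, ?_⟩⟩
      rw [planarCoords_mulVec]
      have hk : Fin.succAbove 2 k = k.castSucc := Fin.succAbove_last_apply k
      exact ⟨abs_cross_sub_le_of_mem_graphTube hW ha hxi, hk ▸ hxi k, hx⟩
  · intro n hn i hi y hy
    refine (abs_sub_le_of_mem_planarSlab ha (hVC n hn i hi) hy).trans ?_
    nlinarith [mul_nonneg hC0 hH, mul_nonneg (mul_nonneg hC0 hC0) hH]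

end Planar

section Slabs

variable {ι : Type*} {s : Fin 3 → Finset ι} {P V : Fin 3 → ι → Fin 2 → ℝ}
  {a : Fin 3 → Fin 2 → ℝ} {c C η X τ ρ R ε : ℝ}

lemma planar_constant_le (hc : 0 < c) (hC : 1 ≤ C) (hX : 0 < X) (hτ : 0 < τ) (hρ : 0 < ρ) {v w : ℝ}
    (hv : c ≤ |v|) (hw : 0 ≤ w) (hwX : w ≤ C * X) :
    |v|⁻¹ * (8 * (2 * C) ^ 2 * (X * τ)) *
        √(4 * w ^ 2 / (c / 2) * (4 * (w * (2 * (2 * C * (X * τ)))) / (X / ρ * (c / 2)))) ≤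
      512 * C ^ 4 / c ^ 2 * (X * (X * τ) * √(X * τ * ρ)) := by
  have hsqrt : √(4 * w ^ 2 / (c / 2) * (4 * (w * (2 * (2 * C * (X * τ)))) / (X / ρ * (c / 2)))) ≤
      16 * C ^ 2 / c * (X * √(X * τ * ρ)) := by
    refine Real.sqrt_le_iff.2 ⟨by positivity, ?_⟩
    rw [mul_pow, mul_pow X, Real.sq_sqrt (by positivity)]
    calc _ ≤ 4 * (C * X) ^ 2 / (c / 2) *
          (4 * (C * X * (2 * (2 * C * (X * τ)))) / (X / ρ * (c / 2))) := by gcongr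
      _ = _ := by
        field_simp
        ring
  calc _ ≤ c⁻¹ * (8 * (2 * C) ^ 2 * (X * τ)) * (16 * C ^ 2 / c * (X * √(X * τ * ρ))) := by
        gcongr
    _ = _ := by
        field_simp
        ring

lemma setLIntegral_slab_le_of_planar_of_near (hc : 0 < c) (hC : 1 ≤ C) (hηc : η ≤ c / (4 * C))
    (hηC : η ≤ C) (ha0 : a 0 = 0) (haC : ∀ n j, |a n j| ≤ C) (hdet : c ≤ |cross (a 1) (a 2)|)
    {k : Fin 2} (hak : c ≤ |a 1 k|) (hk : ![X, X * τ] k ≤ C * X) (hX : 0 < X) (hτ : 1 ≤ τ)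
    (hρ : 0 < ρ) (hR : 0 ≤ R) (hRX : R ≤ X * τ) (hV : ∀ n, ∀ i ∈ s n, ‖V n i - a n‖ ≤ η)
    (z : ℝ) :
    ∫⁻ x in {x | |x 2 - z| ≤ R}, trilinearIntegrand s
        (fun n i => graphTube 2 ![X, X * τ] (P n i) ((![1, 1, X / ρ] n : ℝ) • V n i)) x ≤
      ENNReal.ofReal (512 * C ^ 4 / c ^ 2 * (X * (X * τ) * √(X * τ * ρ))) * sqrtCard s := by
  have hV' : ∀ n, ∀ i ∈ s n, ∀ j, |V n i j - a n j| ≤ η := fun n i hi j =>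
    (norm_le_pi_norm (V n i - a n) j).trans (hV n i hi)
  have hCη : C * η ≤ c / 4 := by
    calc C * η ≤ C * (c / (4 * C)) := by gcongr
      _ = c / 4 := by field_simp
  have hXτ : X ≤ X * τ := le_mul_of_one_le_right hX.le hτ
  have hW : ∀ j, 0 ≤ ![X, X * τ] j := Fin.forall_fin_two.2 ⟨hX.le, hX.le.trans hXτ⟩
  grw [setLIntegral_slab_le_of_planar (a := a 1) (C := 2 * C) (H := X * τ) (κ := c / 2)
    (κ' := X / ρ * (c / 2)) k (hW k) (Fin.forall_fin_two.2 ⟨hXτ, le_rfl⟩) (by linarith) hR hRX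
    (by positivity) (by positivity) (abs_pos.1 (hc.trans_le hak))
    (fun j => (haC 1 j).trans (by linarith)) ?slopes ?transversal ?transversal' z]
  · gcongr ENNReal.ofReal ?_ * _
    exact planar_constant_le hc hC hX (by positivity) hρ hak (hW k) hk
  case slopes =>
    intro n hn i hi j
    have hone : (![1, 1, X / ρ] n : ℝ) = 1 := by
      match n with
      | 0 | 1 => rfl
      | 2 => exact absurd rfl hn
    rw [hone, one_smul]
    linarith [abs_sub_abs_le_abs_sub (V n i j) (a n j), hV' n i hi j, haC n j]
  case transversal =>
    intro i hi i' hi'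
    have h₀ := hV' 0 i hi k
    have h₁ := hV' 1 i' hi' k
    rw [ha0, Pi.zero_apply, sub_zero] at h₀
    simp only [Matrix.cons_val, one_smul]
    have hη : η ≤ C * η := le_mul_of_one_le_left ((abs_nonneg _).trans h₀) hC
    rw [abs_sub_comm] at h₁
    linarith [abs_sub_abs_le_abs_sub (a 1 k) (V 1 i' k), abs_sub (V 1 i' k) (V 0 i k),
      abs_sub_abs_le_abs_sub (V 1 i' k) (V 0 i k)]
  case transversal' =>
    intro i hi
    have hnear := abs_cross_le (haC 1) (hV' 2 i hi)
    simp only [Matrix.cons_val, cross_smul, abs_mul, abs_of_pos (div_pos hX hρ)]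
    gcongr
    change |cross (a 1) (V 2 i - a 2)| ≤ _ at hnear
    rw [cross_sub, abs_sub_comm] at hnear
    linarith [abs_sub_abs_le_abs_sub (cross (a 1) (a 2)) (cross (a 1) (V 2 i))]

lemma covering_constant_le (hε : 0 < ε) (hC : 1 ≤ C) (hX : 0 < X) (hτ : 1 ≤ τ) (hρ : 1 ≤ ρ)
    (hXR : X * τ ≤ R) {w : ℝ} (hw : w ≤ C * X) :
    (X * τ * R) ^ (ε / 2) * (X * (X * τ) * √(X * τ * (1 + w / (X / ρ)))) ≤
      √(1 + C) * (R ^ ε * (X * (X * τ) * √(X * τ * ρ))) := by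
  have hR : 0 < R := (by positivity : 0 < X * τ).trans_le hXR
  have hpow : (X * τ * R) ^ (ε / 2) ≤ R ^ ε := by
    calc (X * τ * R) ^ (ε / 2) ≤ (R * R) ^ (ε / 2) := by gcongr
      _ = R ^ ε := by
        rw [Real.mul_rpow hR.le hR.le, ← Real.rpow_add hR, add_halves]
  have hsqrt : √(X * τ * (1 + w / (X / ρ))) ≤ √(1 + C) * √(X * τ * ρ) := by
    rw [← Real.sqrt_mul (by positivity)]
    refine Real.sqrt_le_sqrt ?_
    calc X * τ * (1 + w / (X / ρ)) ≤ X * τ * (ρ + C * X / (X / ρ)) := by gcongr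
      _ = (1 + C) * (X * τ * ρ) := by field_simp
  calc _ ≤ R ^ ε * (X * (X * τ) * (√(1 + C) * √(X * τ * ρ))) := by gcongr
    _ = _ := by ring

/-- Slabs of dimensions `X × X τ`, the last family moving `X / ρ` times faster. Up to height `X τ`
the problem is planar, and beyond it the slabs are so long that covering them by unit tubes is
efficient. -/
theorem exists_setLIntegral_slab_le {ε c C : ℝ} (hε : 0 < ε) (hc : 0 < c) (hC : 1 ≤ C) :
    ∃ η B : ℝ, 0 < η ∧ 0 < B ∧ ∀ {ι : Type u} (s : Fin 3 → Finset ι) (P V : Fin 3 → ι → Fin 2 → ℝ)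
      (a : Fin 3 → Fin 2 → ℝ) {X τ ρ R : ℝ},
      a 0 = 0 → (∀ n j, |a n j| ≤ C) → c ≤ |cross (a 1) (a 2)| →
      (∀ n ≠ 0, ∃ k, c ≤ |a n k| ∧ ![1, τ] k ≤ C) → 1 ≤ τ → 1 ≤ ρ → ρ ≤ X → 1 ≤ R →
      (∀ n, ∀ i ∈ s n, ‖V n i - a n‖ ≤ η) → ∀ x₀ : Fin 3 → ℝ,
      ∫⁻ x in Metric.closedBall x₀ (X * τ * R) ∩ {x | |x 2 - x₀ 2| ≤ R}, trilinearIntegrand s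
          (fun n i => graphTube 2 ![X, X * τ] (P n i) ((![1, 1, X / ρ] n : ℝ) • V n i)) x ≤
        ENNReal.ofReal (B * (R ^ ε * (X * (X * τ) * √(X * τ * ρ)))) * sqrtCard s := by
  obtain ⟨η₀, B₀, hη₀, hB₀, hcover⟩ := exists_setLIntegral_slab_le_of_covering (half_pos hε) hc hC
  set B₁ : ℝ := 512 * C ^ 4 / c ^ 2
  set B₂ : ℝ := B₀ * √(1 + C)
  refine ⟨min η₀ (min (c / (4 * C)) C), B₁ + B₂, by positivity, by positivity,
    fun {ι} s P V a X τ ρ R ha0 haC hdet hlarge hτ hρ hρX hR hV x₀ => ?_⟩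
  have hX : 1 ≤ X := hρ.trans hρX
  have hXτ : X ≤ X * τ := le_mul_of_one_le_right (by linarith) hτ
  have hwidth : ∀ {k}, ![1, τ] k ≤ C → ![X, X * τ] k ≤ C * X := fun {k} hk => by
    calc ![X, X * τ] k = X * ![1, τ] k := by fin_cases k <;> simp
      _ ≤ X * C := by gcongr
      _ = C * X := mul_comm _ _
  rcases le_total R (X * τ) with hRX | hRX
  · obtain ⟨k, hak, hk⟩ := hlarge 1 (by decide)
    grw [lintegral_mono_set Set.inter_subset_right,
      setLIntegral_slab_le_of_planar_of_near hc hC ((min_le_right _ _).trans (min_le_left _ _))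
        ((min_le_right _ _).trans (min_le_right _ _)) ha0 haC hdet hak (hwidth hk) (by linarith) hτ
        (by linarith) (by linarith) hRX hV]
    gcongr ENNReal.ofReal (?_ * ?_) * _
    · exact le_add_of_nonneg_right (by positivity)
    · exact le_mul_of_one_le_left (by positivity) (Real.one_le_rpow hR hε.le)
  · obtain ⟨k, hak, hk⟩ := hlarge 2 (by decide)
    grw [lintegral_mono_set Set.inter_subset_left,
      hcover s P V a k ha0 haC hdet hak ((one_le_div (by linarith)).2 hρX)
        (Fin.forall_fin_two.2 ⟨hX, hX.trans hXτ⟩) (Fin.forall_fin_two.2 ⟨hXτ, le_rfl⟩)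
        (fun n i hi => (hV n i hi).trans (min_le_left _ _)) x₀ (X * τ * R) (by nlinarith)]
    gcongr ENNReal.ofReal ?_ * _
    calc _ = B₀ * ((X * τ * R) ^ (ε / 2) *
          (X * (X * τ) * √(X * τ * (1 + ![X, X * τ] k / (X / ρ))))) := mul_assoc _ _ _
      _ ≤ B₀ * (√(1 + C) * (R ^ ε * (X * (X * τ) * √(X * τ * ρ)))) :=
          mul_le_mul_of_nonneg_left
            (covering_constant_le hε hC (one_pos.trans_le hX) hτ hρ hRX (hwidth hk)) hB₀.le
      _ = B₂ * (R ^ ε * (X * (X * τ) * √(X * τ * ρ))) := (mul_assoc _ _ _).symm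
      _ ≤ _ := by
          gcongr
          exact le_add_of_nonneg_left (by positivity)

end Slabs

section Galilean

/-- The map `(y, t) ↦ (A (y - t o), t)` of space–time. It takes a line with slope `ξ` to a line with
slope `A (ξ - o)`. -/
def galilean (A : Matrix (Fin 2) (Fin 2) ℝ) (o : Fin 2 → ℝ) : Matrix (Fin 3) (Fin 3) ℝ :=
  !![A 0 0, A 0 1, -A.mulVec o 0; A 1 0, A 1 1, -A.mulVec o 1; 0, 0, 1]

lemma det_galilean (A : Matrix (Fin 2) (Fin 2) ℝ) (o : Fin 2 → ℝ) : (galilean A o).det = A.det := by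
  simp [galilean, Matrix.det_fin_three, Matrix.det_fin_two]

lemma galilean_mulVec_last (A : Matrix (Fin 2) (Fin 2) ℝ) (o : Fin 2 → ℝ) (x : Fin 3 → ℝ) :
    (galilean A o).mulVec x 2 = x 2 := by
  simp [galilean, Matrix.mulVec, dotProduct, Fin.sum_univ_three]

lemma galilean_mulVec_castSucc (A : Matrix (Fin 2) (Fin 2) ℝ) (o : Fin 2 → ℝ) (x : Fin 3 → ℝ)
    (j : Fin 2) :
    (galilean A o).mulVec x j.castSucc = A.mulVec (fun l => x l.castSucc - x 2 * o l) j := by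
  fin_cases j <;>
    simp [galilean, Matrix.mulVec, dotProduct, Fin.sum_univ_three, Fin.sum_univ_two] <;> ring

lemma abs_mulVec_le {m n : Type*} [Fintype n] (A : Matrix m n ℝ) {u : n → ℝ} {δ : ℝ}
    (hu : ∀ l, |u l| ≤ δ) (j : m) : |A.mulVec u j| ≤ (∑ l, |A j l|) * δ := by
  rw [Finset.sum_mul]
  exact (Finset.abs_sum_le_sum_abs _ _).trans (Finset.sum_le_sum fun l _ => by
    rw [abs_mul]
    exact mul_le_mul_of_nonneg_left (hu l) (abs_nonneg _))

variable {A : Matrix (Fin 2) (Fin 2) ℝ} {o W : Fin 2 → ℝ} {b w K R : ℝ}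

lemma galilean_mulVec_mem_graphTube (hW : ∀ j, (∑ l, |A j l|) * w ≤ W j) {P ξ : Fin 2 → ℝ}
    {x : Fin 3 → ℝ} (hx : x ∈ graphTube 2 (fun _ => w) P ξ) :
    (galilean A o).mulVec x ∈ graphTube 2 W (A.mulVec P) (A.mulVec (ξ - o)) := by
  intro j
  have hu : ∀ l, |x l.castSucc - (P l + x 2 * ξ l)| ≤ w := Fin.forall_fin_two.2 ⟨hx 0, hx 1⟩
  have hj := (abs_mulVec_le A hu j).trans (hW j)
  change |(galilean A o).mulVec x ((Fin.last 2).succAbove j) - _| ≤ _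
  rw [Fin.succAbove_last_apply, galilean_mulVec_castSucc, galilean_mulVec_last]
  refine le_of_eq_of_le (congrArg _ ?_) hj
  simp only [Matrix.mulVec, dotProduct, Fin.sum_univ_two, Pi.sub_apply]
  ring

lemma galilean_mulVec_mem_closedBall (hA : ∀ j, ∑ l, |A j l| ≤ K) (hK : 1 ≤ K * (1 + b))
    (hb : 0 ≤ b) (ho : ∀ j, |o j| ≤ b) {x x₀ : Fin 3 → ℝ} (hx : x ∈ Metric.closedBall x₀ R) :
    (galilean A o).mulVec x ∈ Metric.closedBall ((galilean A o).mulVec x₀) (K * (1 + b) * R) := by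
  rw [Metric.mem_closedBall, dist_eq_norm] at hx ⊢
  have hR : 0 ≤ R := (norm_nonneg _).trans hx
  have hx' : ∀ k, |(x - x₀) k| ≤ R := fun k => (norm_le_pi_norm (x - x₀) k).trans hx
  rw [← Matrix.mulVec_sub]
  refine (pi_norm_le_iff_of_nonneg (by positivity)).2 (Fin.lastCases ?_ fun j => ?_)
  · change |(galilean A o).mulVec (x - x₀) 2| ≤ _
    rw [galilean_mulVec_last]
    exact (hx' 2).trans (le_mul_of_one_le_left hR hK)
  · rw [galilean_mulVec_castSucc]
    calc _ ≤ (∑ l, |A j l|) * ((1 + b) * R) := abs_mulVec_le A (fun l => by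
          refine (abs_sub _ _).trans ?_
          rw [abs_mul, one_add_mul, mul_comm b]
          exact add_le_add (hx' _) (mul_le_mul (hx' 2) (ho l) (abs_nonneg _) hR)) j
      _ ≤ K * ((1 + b) * R) := by
          gcongr
          exact hA j
      _ = _ := by ring

lemma setLIntegral_slab_le_galilean {ι : Type*} {s : Fin 3 → Finset ι} {P ξ : Fin 3 → ι → Fin 2 → ℝ}
    (hdet : A.det ≠ 0) (hW : ∀ j, (∑ l, |A j l|) * w ≤ W j) (hA : ∀ j, ∑ l, |A j l| ≤ K)
    (hK : 1 ≤ K * (1 + b)) (hb : 0 ≤ b) (ho : ∀ j, |o j| ≤ b) (x₀ : Fin 3 → ℝ) :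
    ∫⁻ x in Metric.closedBall x₀ R,
        trilinearIntegrand s (fun n i => graphTube 2 (fun _ => w) (P n i) (ξ n i)) x ≤
      ENNReal.ofReal |A.det|⁻¹ * ∫⁻ x in
          Metric.closedBall ((galilean A o).mulVec x₀) (K * (1 + b) * R) ∩
            {x | |x 2 - (galilean A o).mulVec x₀ 2| ≤ R},
        trilinearIntegrand s (fun n i =>
          graphTube 2 W (A.mulVec (P n i)) (A.mulVec (ξ n i - o))) x := by
  rw [← det_galilean A o] at hdet ⊢
  refine setLIntegral_le_of_mulVec hdet
    (measurableSet_closedBall.inter (measurableSet_le (by fun_prop) measurable_const))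
    (measurable_trilinearIntegrand fun _ _ _ => measurableSet_graphTube _ _ _ _) fun x hx =>
    ⟨⟨galilean_mulVec_mem_closedBall hA hK hb ho hx, ?_⟩, trilinearIntegrand_le_of_imp
      fun n i hi hxi => ⟨hi, galilean_mulVec_mem_graphTube hW hxi⟩⟩
  rw [Set.mem_ofPred_eq, galilean_mulVec_last, galilean_mulVec_last]
  exact (norm_le_pi_norm (x - x₀) 2).trans (by simpa [dist_eq_norm] using hx)

end Galilean

section Anisotropic

/-- The components of a plane vector along and across the unit vector `w`, scaled by `Z` and
`Z τ`. -/
def anisotropic (w : Fin 2 → ℝ) (Z τ : ℝ) : Matrix (Fin 2) (Fin 2) ℝ :=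
  !![Z * w 0, Z * w 1; -(Z * τ * w 1), Z * τ * w 0]

variable {w : Fin 2 → ℝ} {c C X Z τ ρ : ℝ}

lemma anisotropic_mulVec_zero (w : Fin 2 → ℝ) (Z τ : ℝ) (ξ : Fin 2 → ℝ) :
    (anisotropic w Z τ).mulVec ξ 0 = Z * (w ⬝ᵥ ξ) := by
  simp only [anisotropic, Matrix.mulVec, dotProduct, Fin.sum_univ_two, Matrix.of_apply,
    Matrix.cons_val]
  ring

lemma anisotropic_mulVec_one (w : Fin 2 → ℝ) (Z τ : ℝ) (ξ : Fin 2 → ℝ) :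
    (anisotropic w Z τ).mulVec ξ 1 = Z * τ * cross w ξ := by
  simp only [anisotropic, cross, Matrix.mulVec, dotProduct, Fin.sum_univ_two, Matrix.of_apply,
    Matrix.cons_val]
  ring

lemma smul_anisotropic (t : ℝ) (w : Fin 2 → ℝ) (Z τ : ℝ) :
    t • anisotropic w Z τ = anisotropic w (t * Z) τ := by
  ext i j
  fin_cases i <;> fin_cases j <;> simp [anisotropic, mul_assoc]

lemma det_anisotropic (hw : w 0 ^ 2 + w 1 ^ 2 = 1) : (anisotropic w Z τ).det = Z ^ 2 * τ := by
  rw [anisotropic, Matrix.det_fin_two_of]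
  linear_combination Z ^ 2 * τ * hw

lemma cross_anisotropic (hw : w 0 ^ 2 + w 1 ^ 2 = 1) (ξ ζ : Fin 2 → ℝ) :
    cross ((anisotropic w X τ).mulVec ξ) ((anisotropic w Z τ).mulVec ζ) =
      X * Z * τ * cross ξ ζ := by
  simp only [cross, anisotropic_mulVec_zero, anisotropic_mulVec_one, dotProduct, Fin.sum_univ_two]
  linear_combination X * Z * τ * (ξ 0 * ζ 1 - ξ 1 * ζ 0) * hw

lemma abs_le_one_of_sq_add_sq_eq_one (hw : w 0 ^ 2 + w 1 ^ 2 = 1) (j : Fin 2) : |w j| ≤ 1 := by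
  rw [← sq_le_one_iff_abs_le_one]
  fin_cases j
  · exact hw ▸ le_add_of_nonneg_right (sq_nonneg _)
  · exact hw ▸ le_add_of_nonneg_left (sq_nonneg _)

lemma sum_abs_anisotropic_le (hw : w 0 ^ 2 + w 1 ^ 2 = 1) (hZ : 0 ≤ Z) (hτ : 0 ≤ τ) (j : Fin 2) :
    ∑ l, |anisotropic w Z τ j l| ≤ ![2 * Z, 2 * (Z * τ)] j := by
  have h₀ := abs_le_one_of_sq_add_sq_eq_one hw 0
  have h₁ := abs_le_one_of_sq_add_sq_eq_one hw 1
  have hZτ : 0 ≤ Z * τ := by positivity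
  fin_cases j <;>
    simp only [anisotropic, Fin.sum_univ_two, Fin.zero_eta, Fin.mk_one, Matrix.of_apply,
      Matrix.cons_val, abs_neg, abs_mul, abs_of_nonneg hZ, abs_of_nonneg hτ] <;>
    nlinarith

lemma norm_le_abs_dotProduct_add_abs_cross (hw : w 0 ^ 2 + w 1 ^ 2 = 1) (ξ : Fin 2 → ℝ) :
    ‖ξ‖ ≤ |w ⬝ᵥ ξ| + |cross w ξ| := by
  have h : ∀ {p q : ℝ}, |p| ≤ 1 → |q| ≤ 1 →
      |p * (w ⬝ᵥ ξ) + q * cross w ξ| ≤ |w ⬝ᵥ ξ| + |cross w ξ| := fun {p q} hp hq => by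
    refine (abs_add_le _ _).trans (add_le_add ?_ ?_) <;> rw [abs_mul]
    exacts [mul_le_of_le_one_left (abs_nonneg _) hp, mul_le_of_le_one_left (abs_nonneg _) hq]
  have h₀ := abs_le_one_of_sq_add_sq_eq_one hw 0
  have h₁ := abs_le_one_of_sq_add_sq_eq_one hw 1
  refine (pi_norm_le_iff_of_nonneg (by positivity)).2 (Fin.forall_fin_two.2 ⟨?_, ?_⟩)
  · refine le_of_eq_of_le (congrArg _ ?_) (h h₀ ((abs_neg (w 1)).trans_le h₁))
    simp only [dotProduct, cross, Fin.sum_univ_two]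
    linear_combination -ξ 0 * hw
  · refine le_of_eq_of_le (congrArg _ ?_) (h h₁ h₀)
    simp only [dotProduct, cross, Fin.sum_univ_two]
    linear_combination -ξ 1 * hw

/-- If only the component across `w` is large, its bound by `C` forces `τ` to be bounded. -/
lemma exists_le_abs_anisotropic_mulVec (hw : w 0 ^ 2 + w 1 ^ 2 = 1) (hc : 0 < c) (hC : 0 ≤ C)
    (hZ : 0 < Z) (hτ : 1 ≤ τ) {ξ : Fin 2 → ℝ} (hξ : c ≤ Z * ‖ξ‖)
    (hacross : |(anisotropic w Z τ).mulVec ξ 1| ≤ C) :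
    ∃ k, c / 2 ≤ |(anisotropic w Z τ).mulVec ξ k| ∧ ![1, τ] k ≤ 1 + 2 * C / c := by
  have hsum : c ≤ Z * |w ⬝ᵥ ξ| + Z * |cross w ξ| := by
    rw [← mul_add]
    exact hξ.trans (mul_le_mul_of_nonneg_left (norm_le_abs_dotProduct_add_abs_cross hw ξ) hZ.le)
  rw [anisotropic_mulVec_one, abs_mul, abs_of_pos (by positivity)] at hacross
  rcases le_total (c / 2) (Z * |w ⬝ᵥ ξ|) with h | h
  · refine ⟨0, ?_, le_add_of_nonneg_right (by positivity)⟩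
    rwa [anisotropic_mulVec_zero, abs_mul, abs_of_pos hZ]
  · have hcross : c / 2 ≤ Z * |cross w ξ| := by linarith
    refine ⟨1, ?_, ?_⟩
    · rw [anisotropic_mulVec_one, abs_mul, abs_of_pos (by positivity)]
      exact hcross.trans (by gcongr; exact le_mul_of_one_le_right hZ.le hτ)
    · have hτC : τ ≤ 2 * C / c := (le_div_iff₀ hc).2 (by
        linarith [mul_le_mul_of_nonneg_left hcross (zero_le_one.trans hτ)])
      exact hτC.trans (le_add_of_nonneg_left zero_le_one)

end Anisotropic

section Cells

variable {ι κ α : Type*}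

lemma multiplicity_rpow_half_le_sum_fiber [DecidableEq κ] {s : Finset ι} {J : Finset κ} {f : ι → κ}
    (hf : ∀ i ∈ s, f i ∈ J) (U : ι → Set α) (x : α) :
    multiplicity s U x ^ (1 / 2 : ℝ) ≤
      ∑ k ∈ J, multiplicity (s.filter fun i => f i = k) U x ^ (1 / 2 : ℝ) := by
  rw [multiplicity, ← Finset.sum_fiberwise_of_maps_to hf]
  exact Finset.le_sum_of_subadditive (fun a : ℝ≥0∞ => a ^ (1 / 2 : ℝ))
    (ENNReal.zero_rpow_of_pos (by norm_num)).le
    (fun a b => ENNReal.rpow_add_le_add_rpow a b (by norm_num) (by norm_num)) _ _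

lemma trilinearIntegrand_le_sum_fiber [DecidableEq κ] {s : Fin 3 → Finset ι} {J : Finset κ}
    {f : Fin 3 → ι → κ} (hf : ∀ n, ∀ i ∈ s n, f n i ∈ J) (U : Fin 3 → ι → Set α) (x : α) :
    trilinearIntegrand s U x ≤ ∑ k ∈ Fintype.piFinset fun _ => J,
      trilinearIntegrand (fun n => (s n).filter fun i => f n i = k n) U x := by
  simp only [trilinearIntegrand]
  rw [← Finset.prod_univ_sum (fun _ => J) fun n k =>
    multiplicity ((s n).filter fun i => f n i = k) (U n) x ^ (1 / 2 : ℝ)]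
  exact Finset.prod_le_prod' fun n _ => multiplicity_rpow_half_le_sum_fiber (hf n) (U n) x

lemma lintegral_trilinearIntegrand_le_of_cells [DecidableEq κ] [MeasurableSpace α] (μ : Measure α)
    {s : Fin 3 → Finset ι} {J : Finset κ} {f : Fin 3 → ι → κ} (hf : ∀ n, ∀ i ∈ s n, f n i ∈ J)
    {U : Fin 3 → ι → Set α} (hU : ∀ n, ∀ i ∈ s n, MeasurableSet (U n i)) {B : ℝ≥0∞}
    (h : ∀ k : Fin 3 → κ, (∀ n, ((s n).filter fun i => f n i = k n).Nonempty) →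
      ∫⁻ x, trilinearIntegrand (fun n => (s n).filter fun i => f n i = k n) U x ∂μ ≤
        B * sqrtCard fun n => (s n).filter fun i => f n i = k n) :
    ∫⁻ x, trilinearIntegrand s U x ∂μ ≤ J.card ^ 3 * B * sqrtCard s := by
  have hcell : ∀ k : Fin 3 → κ,
      ∫⁻ x, trilinearIntegrand (fun n => (s n).filter fun i => f n i = k n) U x ∂μ ≤
        B * sqrtCard s := fun k => by
    by_cases hk : ∀ n, ((s n).filter fun i => f n i = k n).Nonempty
    · exact (h k hk).trans (mul_le_mul_right (sqrtCard_mono fun n => Finset.filter_subset _ _) B)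
    · obtain ⟨n, hn⟩ := not_forall.1 hk
      have hzero : ∀ x, trilinearIntegrand (fun n => (s n).filter fun i => f n i = k n) U x = 0 :=
        fun x => Finset.prod_eq_zero (Finset.mem_univ n) (by
          simp [multiplicity, Finset.not_nonempty_iff_eq_empty.1 hn])
      simp [hzero]
  calc _ ≤ ∫⁻ x, ∑ k ∈ Fintype.piFinset fun _ => J,
        trilinearIntegrand (fun n => (s n).filter fun i => f n i = k n) U x ∂μ :=
        lintegral_mono (trilinearIntegrand_le_sum_fiber hf U)
    _ = ∑ k ∈ Fintype.piFinset fun _ => J,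
        ∫⁻ x, trilinearIntegrand (fun n => (s n).filter fun i => f n i = k n) U x ∂μ :=
        lintegral_finsetSum _ fun k _ =>
          measurable_trilinearIntegrand fun n i hi => hU n i (Finset.mem_filter.1 hi).1
    _ ≤ ∑ _k ∈ Fintype.piFinset fun _ : Fin 3 => J, B * sqrtCard s :=
        Finset.sum_le_sum fun k _ => hcell k
    _ = _ := by simp [mul_assoc]

end Cells

section Frequencies

lemma smul_anisotropic_mulVec {X ρ : ℝ} (hρ : ρ ≠ 0) (w : Fin 2 → ℝ) (τ : ℝ) (n : Fin 3)
    (v : Fin 2 → ℝ) :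
    (![1, 1, X / ρ] n : ℝ) • (anisotropic w (![X, X, ρ] n) τ).mulVec v =
      (anisotropic w X τ).mulVec v := by
  rw [← Matrix.smul_mulVec, smul_anisotropic]
  match n with
  | 0 | 1 => simp
  | 2 => simp [div_mul_cancel₀ _ hρ]

lemma norm_anisotropic_mulVec_le {X ρ : ℝ} (hρ : 0 < ρ) (hρX : ρ ≤ X) (w : Fin 2 → ℝ) (τ : ℝ)
    (n : Fin 3) (v : Fin 2 → ℝ) :
    ‖(anisotropic w (![X, X, ρ] n) τ).mulVec v‖ ≤ ‖(anisotropic w X τ).mulVec v‖ := by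
  have hspeed : ∀ n, (1 : ℝ) ≤ ![1, 1, X / ρ] n := fun n =>
    match n with
    | 0 | 1 => le_rfl
    | 2 => (one_le_div hρ).2 hρX
  calc ‖(anisotropic w (![X, X, ρ] n) τ).mulVec v‖
      ≤ |![1, 1, X / ρ] n| * ‖(anisotropic w (![X, X, ρ] n) τ).mulVec v‖ :=
        le_mul_of_one_le_left (by positivity) ((hspeed n).trans (le_abs_self _))
    _ = ‖(anisotropic w X τ).mulVec v‖ := by
        rw [← smul_anisotropic_mulVec (X := X) hρ.ne' w τ n, norm_smul, Real.norm_eq_abs]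

lemma setLIntegral_slab_le_anisotropic {ι : Type*} {s : Fin 3 → Finset ι}
    {P ξ : Fin 3 → ι → Fin 2 → ℝ} {w o : Fin 2 → ℝ} {X τ ρ R : ℝ} (hw : w 0 ^ 2 + w 1 ^ 2 = 1)
    (hX : 1 ≤ X) (hτ : 1 ≤ τ) (hρ : ρ ≠ 0) (ho : ∀ j, |o j| ≤ 2) (x₀ : Fin 3 → ℝ) :
    ∫⁻ x in Metric.closedBall x₀ R,
        trilinearIntegrand s (fun n i => graphTube 2 (fun _ => 3) (P n i) (ξ n i)) x ≤
      ENNReal.ofReal (X ^ 2 * τ)⁻¹ * ∫⁻ x in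
          Metric.closedBall ((galilean (anisotropic w X τ) o).mulVec x₀) (6 * X * τ * R) ∩
            {x | |x 2 - (galilean (anisotropic w X τ) o).mulVec x₀ 2| ≤ R},
        trilinearIntegrand s (fun n i => graphTube 2 ![6 * X, 6 * X * τ]
          ((anisotropic w X τ).mulVec (P n i)) ((![1, 1, 6 * X / (6 * ρ)] n : ℝ) •
            (anisotropic w (![X, X, ρ] n) τ).mulVec (ξ n i - o))) x := by
  have hdet : (anisotropic w X τ).det = X ^ 2 * τ := det_anisotropic hw
  have hpos : 0 < X ^ 2 * τ := by positivity
  have hXτ : X ≤ X * τ := le_mul_of_one_le_right (by positivity) hτ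
  have hsum := sum_abs_anisotropic_le (Z := X) (τ := τ) hw (by positivity) (by positivity)
  have h := setLIntegral_slab_le_galilean (A := anisotropic w X τ) (s := s) (P := P) (ξ := ξ)
    (w := 3) (W := ![6 * X, 6 * X * τ]) (K := 2 * (X * τ)) (R := R) (hdet ▸ hpos.ne')
    (Fin.forall_fin_two.2 ⟨(mul_le_mul_of_nonneg_right (hsum 0) zero_le_three).trans_eq ?_,
      (mul_le_mul_of_nonneg_right (hsum 1) zero_le_three).trans_eq ?_⟩)
    (Fin.forall_fin_two.2 ⟨(hsum 0).trans (mul_le_mul_of_nonneg_left hXτ zero_le_two), hsum 1⟩)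
    (by linarith) zero_le_two ho x₀
  · have hR : 2 * (X * τ) * (1 + 2) * R = 6 * X * τ * R := by ring
    simpa only [hdet, abs_of_pos hpos, hR, mul_div_mul_left X ρ (by norm_num : (6 : ℝ) ≠ 0),
      smul_anisotropic_mulVec hρ] using h
  all_goals
    simp only [Matrix.cons_val]
    ring

/-- In the coordinates adapted to `w`, moving with the reference frequency of the first family, the
frequency differences are of size `1` and transversal. -/
theorem exists_setLIntegral_slab_le_of_near {ε c C : ℝ} (hε : 0 < ε) (hc : 0 < c) (hC : 1 ≤ C) :
    ∃ η B : ℝ, 0 < η ∧ 0 < B ∧ ∀ {ι : Type u} (s : Fin 3 → Finset ι) (P ξ : Fin 3 → ι → Fin 2 → ℝ)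
      (b : Fin 3 → Fin 2 → ℝ) {w : Fin 2 → ℝ} {X τ ρ R : ℝ}, w 0 ^ 2 + w 1 ^ 2 = 1 →
      1 ≤ τ → 1 ≤ ρ → ρ ≤ X → 1 ≤ R → (∀ j, |b 0 j| ≤ 2) →
      (∀ n, ‖(anisotropic w (![X, X, ρ] n) τ).mulVec (b n - b 0)‖ ≤ C) →
      (∀ n ≠ 0, c ≤ (![X, X, ρ] n : ℝ) * ‖b n - b 0‖) →
      c ≤ X * ρ * τ * |cross (b 1 - b 0) (b 2 - b 0)| →
      (∀ n, ∀ i ∈ s n, ‖(anisotropic w (![X, X, ρ] n) τ).mulVec (ξ n i - b n)‖ ≤ η) →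
      ∀ x₀ : Fin 3 → ℝ, ∫⁻ x in Metric.closedBall x₀ R,
          trilinearIntegrand s (fun n i => graphTube 2 (fun _ => 3) (P n i) (ξ n i)) x ≤
        ENNReal.ofReal (B * (R ^ ε * √(X * τ * ρ))) * sqrtCard s := by
  have hC' : 0 ≤ 2 * C / c := by positivity
  obtain ⟨η, B, hη, hB, hslab⟩ := exists_setLIntegral_slab_le hε (half_pos hc)
    (by linarith : 1 ≤ C + 2 * C / c)
  refine ⟨η, 216 * B, hη, by positivity,
    fun s P ξ b w X τ ρ R hw hτ hρ hρX hR hb hbC hbc hdet hξ x₀ => ?_⟩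
  have hX : 1 ≤ X := hρ.trans hρX
  have hZ : ∀ n, (0 : ℝ) < ![X, X, ρ] n := fun n => by fin_cases n <;> positivity
  have hcomponent : ∀ n j, |(anisotropic w (![X, X, ρ] n) τ).mulVec (b n - b 0) j| ≤ C :=
    fun n j => (norm_le_pi_norm _ j).trans (hbC n)
  grw [setLIntegral_slab_le_anisotropic (ρ := ρ) hw hX hτ (by positivity) hb x₀,
    hslab s _ _ (fun n => (anisotropic w (![X, X, ρ] n) τ).mulVec (b n - b 0)) (by simp)
      (fun n j => (hcomponent n j).trans (le_add_of_nonneg_right hC')) ?transversal ?large hτ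
      (by linarith) (by linarith) hR ?near]
  · rw [← mul_assoc, ← ENNReal.ofReal_mul (by positivity)]
    have hsqrt : √(6 * X * τ * (6 * ρ)) = 6 * √(X * τ * ρ) := by
      rw [show 6 * X * τ * (6 * ρ) = 6 ^ 2 * (X * τ * ρ) by ring, Real.sqrt_mul (by positivity),
        Real.sqrt_sq (by norm_num)]
    rw [hsqrt]
    refine le_of_eq (congrArg (ENNReal.ofReal · * _) ?_)
    field_simp
    ring
  case transversal =>
    rw [show (![X, X, ρ] 1 : ℝ) = X from rfl, show (![X, X, ρ] 2 : ℝ) = ρ from rfl,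
      cross_anisotropic hw, abs_mul, abs_of_pos (by positivity)]
    linarith
  case large =>
    intro n hn
    obtain ⟨k, hk, hk'⟩ := exists_le_abs_anisotropic_mulVec hw hc (by linarith) (hZ n) hτ
      (hbc n hn) (hcomponent n 1)
    exact ⟨k, hk, hk'.trans (by linarith)⟩
  case near =>
    intro n i hi
    rw [← Matrix.mulVec_sub, sub_sub_sub_cancel_right]
    exact hξ n i hi

lemma exists_finset_forall_norm_sub_lt {E : Type*} [SeminormedAddCommGroup E] [ProperSpace E]
    (C : ℝ) {η : ℝ} (hη : 0 < η) : ∃ J : Finset E, ∀ v : E, ‖v‖ ≤ C → ∃ y ∈ J, ‖v - y‖ < η := by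
  obtain ⟨J, -, hJ, hcover⟩ := (isCompact_closedBall (0 : E) C).finite_cover_balls hη
  refine ⟨hJ.toFinset, fun v hv => ?_⟩
  obtain ⟨y, hy, hdist⟩ := Set.mem_iUnion₂.1 (hcover (mem_closedBall_zero_iff.2 hv))
  exact ⟨y, hJ.mem_toFinset.2 hy, by rwa [Metric.mem_ball, dist_eq_norm] at hdist⟩

/-- Cells of size `η` in the coordinates adapted to `w` provide the reference frequencies. -/
theorem exists_setLIntegral_slab_le_of_frequencies {ε c C : ℝ} (hε : 0 < ε) (hc : 0 < c)
    (hC : 1 ≤ C) :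
    ∃ B : ℝ, 0 ≤ B ∧ ∀ {ι : Type u} (s : Fin 3 → Finset ι) (P ξ : Fin 3 → ι → Fin 2 → ℝ)
      {w m : Fin 2 → ℝ} {X τ ρ R : ℝ}, w 0 ^ 2 + w 1 ^ 2 = 1 → 1 ≤ τ → 1 ≤ ρ → ρ ≤ X → 1 ≤ R →
      (∀ i ∈ s 0, ∀ j, |ξ 0 i j| ≤ 2) →
      (∀ n, ∀ i ∈ s n, ‖(anisotropic w (![X, X, ρ] n) τ).mulVec (ξ n i - m)‖ ≤ C) →
      (∀ n ≠ 0, ∀ i ∈ s n, ∀ i₀ ∈ s 0, c ≤ (![X, X, ρ] n : ℝ) * ‖ξ n i - ξ 0 i₀‖) →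
      (∀ i₀ ∈ s 0, ∀ i₁ ∈ s 1, ∀ i₂ ∈ s 2,
        c ≤ X * ρ * τ * |cross (ξ 1 i₁ - ξ 0 i₀) (ξ 2 i₂ - ξ 0 i₀)|) →
      ∀ x₀ : Fin 3 → ℝ, ∫⁻ x in Metric.closedBall x₀ R,
          trilinearIntegrand s (fun n i => graphTube 2 (fun _ => 3) (P n i) (ξ n i)) x ≤
        ENNReal.ofReal (B * (R ^ ε * √(X * τ * ρ))) * sqrtCard s := by
  classical
  obtain ⟨η, B, hη, hB, hnear⟩ := exists_setLIntegral_slab_le_of_near hε hc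
    (by linarith : 1 ≤ 2 * C)
  obtain ⟨J, hJ⟩ := exists_finset_forall_norm_sub_lt (E := Fin 2 → ℝ) C (half_pos hη)
  refine ⟨J.card ^ 3 * B, by positivity,
    fun s P ξ w m X τ ρ R hw hτ hρ hρX hR hξ₀ hξ hsep hdet x₀ => ?_⟩
  set Λ : Fin 3 → Matrix (Fin 2) (Fin 2) ℝ := fun n => anisotropic w (![X, X, ρ] n) τ
  choose! f hfJ hf using fun n i hi => hJ _ (hξ n i hi)
  grw [lintegral_trilinearIntegrand_le_of_cells (f := f)
    (B := ENNReal.ofReal (B * (R ^ ε * √(X * τ * ρ)))) _ hfJ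
    (fun _ _ _ => measurableSet_graphTube _ _ _ _) fun k hk => ?_]
  · rw [← ENNReal.ofReal_natCast, ← ENNReal.ofReal_pow (by positivity),
      ← ENNReal.ofReal_mul (by positivity), ← mul_assoc]
  choose i₀ hi₀ using hk
  simp only [Finset.mem_filter] at hi₀
  refine hnear _ P ξ (fun n => ξ n (i₀ n)) hw hτ hρ hρX hR (hξ₀ _ (hi₀ 0).1) (fun n => ?_)
    (fun n hn => hsep n hn _ (hi₀ n).1 _ (hi₀ 0).1)
    (hdet _ (hi₀ 0).1 _ (hi₀ 1).1 _ (hi₀ 2).1) (fun n i hi => ?_) x₀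
  · have h₀ : ‖(Λ n).mulVec (ξ 0 (i₀ 0) - m)‖ ≤ C :=
      (norm_anisotropic_mulVec_le (by linarith) hρX w τ n _).trans (hξ 0 _ (hi₀ 0).1)
    rw [← sub_sub_sub_cancel_right _ _ m, Matrix.mulVec_sub, two_mul]
    exact (norm_sub_le _ _).trans (add_le_add (hξ n _ (hi₀ n).1) h₀)
  · obtain ⟨hi, hik⟩ := Finset.mem_filter.1 hi
    have hclose : ∀ i, i ∈ s n → f n i = k n → ‖(Λ n).mulVec (ξ n i - m) - k n‖ < η / 2 :=
      fun i hi hik => hik ▸ hf n i hi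
    rw [← sub_sub_sub_cancel_right _ _ m, Matrix.mulVec_sub, ← sub_sub_sub_cancel_right _ _ (k n),
      ← add_halves η]
    exact (norm_sub_le _ _).trans
      (add_le_add (hclose i hi hik).le (hclose _ (hi₀ n).1 (hi₀ n).2).le)

end Frequencies

section Plane

lemma norm_ofLp_le {m : Type*} [Fintype m] (x : EuclideanSpace ℝ m) : ‖x.ofLp‖ ≤ ‖x‖ :=
  (pi_norm_le_iff_of_nonneg (norm_nonneg x)).2 (PiLp.norm_apply_le x)

lemma norm_sq_eq_sq_add_sq (ξ : E2) : ‖ξ‖ ^ 2 = ξ 0 ^ 2 + ξ 1 ^ 2 := by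
  simp [EuclideanSpace.norm_sq_eq, Fin.sum_univ_two]

lemma norm_le_two_mul_norm_ofLp (ξ : E2) : ‖ξ‖ ≤ 2 * ‖ξ.ofLp‖ := by
  have h : ∀ i, ξ i ^ 2 ≤ ‖ξ.ofLp‖ ^ 2 := fun i => sq_le_sq' (abs_le.1 (norm_le_pi_norm ξ.ofLp i)).1
    (abs_le.1 (norm_le_pi_norm ξ.ofLp i)).2
  refine le_of_sq_le_sq ?_ (by positivity)
  rw [norm_sq_eq_sq_add_sq]
  nlinarith [h 0, h 1]

lemma cross_neg_neg (ξ ζ : Fin 2 → ℝ) : cross (-ξ) (-ζ) = cross ξ ζ := by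
  simp [cross]

lemma abs_cross_le_norm_mul_norm (w u : E2) : |cross w.ofLp u.ofLp| ≤ ‖w‖ * ‖u‖ := by
  refine abs_le_of_sq_le_sq ?_ (by positivity)
  rw [mul_pow, norm_sq_eq_sq_add_sq, norm_sq_eq_sq_add_sq, cross]
  nlinarith [sq_nonneg (w 0 * u 0 + w 1 * u 1)]

lemma inner_eq_dotProduct (w u : E2) : inner ℝ u w = w.ofLp ⬝ᵥ u.ofLp := by
  rw [EuclideanSpace.inner_eq_star_dotProduct, star_trivial]

lemma norm_sub_inner_smul {w : E2} (hw : ‖w‖ = 1) (u : E2) :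
    ‖u - inner ℝ u w • w‖ = |cross w.ofLp u.ofLp| := by
  have hw' : w 0 ^ 2 + w 1 ^ 2 = 1 := by rw [← norm_sq_eq_sq_add_sq, hw, one_pow]
  rw [← sq_eq_sq₀ (norm_nonneg _) (abs_nonneg _), sq_abs, norm_sq_eq_sq_add_sq,
    inner_eq_dotProduct]
  simp only [cross, Matrix.vec2_dotProduct, PiLp.sub_apply, PiLp.smul_apply, smul_eq_mul]
  linear_combination ((w 0 * u 0 + w 1 * u 1) ^ 2 - (u 0 ^ 2 + u 1 ^ 2)) * hw'

lemma norm_anisotropic_mulVec_le_of_norm_sub_le {w ω u : E2} {A D Z τ : ℝ} (hw : ‖w‖ = 1)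
    (hA : 1 ≤ A) (hZ : 0 < Z) (hτ : 0 < τ) (hω : ‖w - ω‖ ≤ A * τ⁻¹) (hu : ‖u‖ ≤ D * Z⁻¹)
    (hcross : |cross ω.ofLp u.ofLp| ≤ (Z * τ)⁻¹) :
    ‖(anisotropic w.ofLp Z τ).mulVec u.ofLp‖ ≤ 1 + A * D := by
  have hD : 0 ≤ D := nonneg_of_mul_nonneg_left ((norm_nonneg u).trans hu) (inv_pos.2 hZ)
  refine (pi_norm_le_iff_of_nonneg (by positivity)).2 (Fin.forall_fin_two.2 ⟨?_, ?_⟩)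
  · rw [anisotropic_mulVec_zero, ← inner_eq_dotProduct, norm_mul, Real.norm_of_nonneg hZ.le]
    calc Z * ‖inner ℝ u w‖ ≤ Z * (D * Z⁻¹) := by
          gcongr
          exact (norm_inner_le_norm u w).trans (by rwa [hw, mul_one])
      _ = D := by field_simp
      _ ≤ 1 + A * D := by nlinarith
  · rw [anisotropic_mulVec_one, Real.norm_eq_abs, abs_mul, abs_of_pos (by positivity)]
    have hsplit : cross w.ofLp u.ofLp = cross ω.ofLp u.ofLp + cross (w - ω).ofLp u.ofLp := by
      simp only [cross, PiLp.sub_apply]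
      ring
    calc Z * τ * |cross w.ofLp u.ofLp|
        ≤ Z * τ * ((Z * τ)⁻¹ + A * τ⁻¹ * (D * Z⁻¹)) := by
          rw [hsplit]
          gcongr
          refine (abs_add_le _ _).trans (add_le_add hcross ?_)
          grw [abs_cross_le_norm_mul_norm, hω, hu]
      _ = 1 + A * D := by field_simp

end Plane

section Squares

lemma two_rpow_neg_natCast (j : ℕ) : (2 : ℝ) ^ (-(j : ℝ)) = (2 ^ j)⁻¹ := by
  rw [Real.rpow_neg two_pos.le, Real.rpow_natCast]

lemma corner_mem_square (j : ℕ) (k : E2) : k ∈ square j k := fun _ =>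
  ⟨le_rfl, le_add_of_nonneg_right (Real.rpow_pos_of_pos two_pos _).le⟩

lemma dist_le_of_mem_square {j : ℕ} {k p q : E2} (hp : p ∈ square j k) (hq : q ∈ square j k) :
    dist p q ≤ 2 * 2 ^ (-(j : ℝ)) := by
  rw [dist_eq_norm]
  refine (norm_le_two_mul_norm_ofLp _).trans (mul_le_mul_of_nonneg_left ?_ zero_le_two)
  refine (pi_norm_le_iff_of_nonneg (Real.rpow_pos_of_pos two_pos _).le).2 fun i => ?_
  rw [Real.norm_eq_abs, PiLp.sub_apply, abs_le]
  constructor <;> linarith [(hp i).1, (hp i).2, (hq i).1, (hq i).2]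

lemma setDist_le_dist {S S' : Set E2} {p q : E2} (hp : p ∈ S) (hq : q ∈ S') :
    setDist S S' ≤ dist p q :=
  csInf_le ⟨0, Set.forall_mem_image2.2 fun _ _ _ _ => dist_nonneg⟩ (Set.mem_image2_of_mem hp hq)

lemma dist_le_of_setDist_square_le {i j : ℕ} {k k' p q : E2} {A s : ℝ}
    (hi : (2 : ℝ) ^ (-(i : ℝ)) ≤ s) (hj : (2 : ℝ) ^ (-(j : ℝ)) ≤ s)
    (h : setDist (square i k) (square j k') ≤ A * s) (hp : p ∈ square i k)
    (hq : q ∈ square j k') : dist p q ≤ (A + 5) * s := by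
  have hpos : 0 < s := (Real.rpow_pos_of_pos two_pos _).trans_le hi
  have hlt : sInf (Set.image2 dist (square i k) (square j k')) < A * s + s :=
    h.trans_lt (by linarith)
  obtain ⟨_, ⟨p', hp', q', hq', rfl⟩, hd⟩ := exists_lt_of_csInf_lt
    ⟨_, Set.mem_image2_of_mem (corner_mem_square i k) (corner_mem_square j k')⟩ hlt
  have hpp' := dist_le_of_mem_square hp hp'
  have hqq' := dist_le_of_mem_square hq' hq
  linarith [dist_triangle4 p p' q' q]

end Squares

section Paraboloid

lemma unitNormal_lift (ξ : E2) :
    unitNormal (lift ξ) = (√(1 + ξ 0 ^ 2 + ξ 1 ^ 2))⁻¹ • !₂[ξ 0, ξ 1, -1] := by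
  simp [unitNormal, lift]

lemma wedge_comp_perm (σ : Equiv.Perm (Fin 3)) (u : Fin 3 → E3) :
    wedge (u (σ 0)) (u (σ 1)) (u (σ 2)) = wedge (u 0) (u 1) (u 2) := by
  have hrows : ∀ v : Fin 3 → E3, Matrix.of ![(v 0).ofLp, (v 1).ofLp, (v 2).ofLp] =
      Matrix.of fun i => (v i).ofLp := fun v => by
    ext i k
    fin_cases i <;> rfl
  have hpermute := Matrix.det_permute σ (Matrix.of fun i => (u i).ofLp)
  rw [wedge, wedge, hrows u, hrows fun n => u (σ n)]
  refine (congrArg abs hpermute).trans ?_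
  rcases Int.units_eq_one_or (Equiv.Perm.sign σ) with hs | hs <;> simp [hs]

lemma wedge_unitNormal_lift_le (ξ₁ ξ₂ ξ₃ : E2) :
    wedge (unitNormal (lift ξ₁)) (unitNormal (lift ξ₂)) (unitNormal (lift ξ₃)) ≤
      |cross (ξ₂ - ξ₁).ofLp (ξ₃ - ξ₁).ofLp| := by
  have hN : ∀ ξ : E2, (√(1 + ξ 0 ^ 2 + ξ 1 ^ 2))⁻¹ ≤ 1 := fun ξ =>
    inv_le_one_of_one_le₀ (Real.one_le_sqrt.2 (by nlinarith))
  simp only [unitNormal_lift]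
  set N : E2 → ℝ := fun ξ => (√(1 + ξ 0 ^ 2 + ξ 1 ^ 2))⁻¹
  have hN₀ : ∀ ξ, 0 ≤ N ξ := fun ξ => by positivity
  have hdet : (Matrix.of ![(N ξ₁ • !₂[ξ₁ 0, ξ₁ 1, -1] : E3).ofLp,
      (N ξ₂ • !₂[ξ₂ 0, ξ₂ 1, -1] : E3).ofLp, (N ξ₃ • !₂[ξ₃ 0, ξ₃ 1, -1] : E3).ofLp]).det =
      -(N ξ₁ * N ξ₂ * N ξ₃) * cross (ξ₂ - ξ₁).ofLp (ξ₃ - ξ₁).ofLp := by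
    simp [Matrix.det_fin_three, cross]
    ring
  rw [wedge, hdet, abs_mul, abs_neg, abs_of_nonneg (by positivity)]
  exact mul_le_of_le_one_left (abs_nonneg _) (mul_le_one₀
    (mul_le_one₀ (hN _) (hN₀ _) (hN _)) (hN₀ _) (hN _))

lemma ofLp_mem_graphTube {T : Tube} {ξ : E2} (hdir : T.dir = unitNormal (lift ξ))
    (hξ : ∀ i, |ξ i| ≤ 2) {x : E3} (hx : x ∈ T.carrier) :
    x.ofLp ∈ graphTube 2 (fun _ => 3) (intercept 2 T.base.ofLp T.dir.ofLp) (-ξ.ofLp) := by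
  have hpos : 0 < √(1 + ξ 0 ^ 2 + ξ 1 ^ 2) := Real.sqrt_pos.2 (by positivity)
  have hslope : slope 2 T.dir.ofLp = -ξ.ofLp := by
    have hquot : T.dir 0 / T.dir 2 = -ξ 0 ∧ T.dir 1 / T.dir 2 = -ξ 1 := by
      simp only [hdir, unitNormal_lift, PiLp.smul_apply, smul_eq_mul, Matrix.cons_val]
      constructor <;> field_simp
    exact funext (Fin.forall_fin_two.2 hquot)
  have hvertical : T.dir.ofLp 2 ≠ 0 := by simp [hdir, unitNormal_lift, hpos.ne']
  have hflat : ‖slope 2 T.dir.ofLp‖ ≤ 2 := by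
    rw [hslope, norm_neg]
    exact (pi_norm_le_iff_of_nonneg zero_le_two).2 hξ
  obtain ⟨s, hs⟩ := hx
  rw [dist_eq_norm] at hs
  have hmem := lineTube_subset_graphTube hvertical hflat T.base.ofLp
    (show x.ofLp ∈ lineTube 1 T.base.ofLp T.dir.ofLp from ⟨s, (norm_ofLp_le _).trans hs⟩)
  rwa [hslope, show ((1 : ℝ) + 2) * 1 = 3 by norm_num] at hmem

end Paraboloid

lemma setLIntegral_closedBall_le_of_ofLp {m : Type*} [Fintype m]
    {f : EuclideanSpace ℝ m → ℝ≥0∞} {g : (m → ℝ) → ℝ≥0∞}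
    (hfg : ∀ x, f x ≤ g x.ofLp) (a : EuclideanSpace ℝ m) (R : ℝ) :
    ∫⁻ x in Metric.closedBall a R, f x ≤ ∫⁻ x in Metric.closedBall a.ofLp R, g x := by
  have hball : Metric.closedBall a R ⊆ WithLp.ofLp ⁻¹' Metric.closedBall a.ofLp R := fun x hx => by
    rw [Metric.mem_closedBall, dist_eq_norm] at hx
    rw [Set.mem_preimage, Metric.mem_closedBall, dist_eq_norm]
    exact (norm_ofLp_le (x - a)).trans hx
  calc _ ≤ ∫⁻ x in WithLp.ofLp ⁻¹' Metric.closedBall a.ofLp R, g x.ofLp :=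
        lintegral_mono' (Measure.restrict_mono hball le_rfl) hfg
    _ = _ := (PiLp.volume_preserving_ofLp m).setLIntegral_comp_preimage_emb
        (MeasurableEquiv.toLp 2 (m → ℝ)).symm.measurableEmbedding _ _

section Types

lemma norm_anisotropic_mulVec_sub_le {A : ℝ} {l j t : ℕ} {k k' w ω m ξ : E2} (hA : 1 ≤ A)
    (hlj : l ≤ j) (hw : ‖w‖ = 1) (hω : ‖ω‖ = 1) (hwω : ‖w - ω‖ ≤ A * (2 ^ t)⁻¹)
    (hm : m ∈ square j k) (hkk' : setDist (square j k) (square l k') ≤ A * (2 ^ l)⁻¹)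
    (hξ : ξ ∈ square l k' ∩ strip (l + t) ω m) :
    ‖(anisotropic w.ofLp (2 ^ l) (2 ^ t)).mulVec (ξ - m).ofLp‖ ≤ 1 + A * (A + 5) := by
  have hlj' : (2 : ℝ) ^ (-(j : ℝ)) ≤ (2 ^ l)⁻¹ := by
    rw [two_rpow_neg_natCast]
    gcongr
    exact one_le_two
  refine norm_anisotropic_mulVec_le_of_norm_sub_le hw hA (by positivity) (by positivity) hwω ?_ ?_
  · rw [← dist_eq_norm, dist_comm]
    exact dist_le_of_setDist_square_le hlj' (two_rpow_neg_natCast l).le hkk' hm hξ.1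
  · rw [← norm_sub_inner_smul hω, ← pow_add, ← two_rpow_neg_natCast]
    exact hξ.2.2

lemma inv_le_two_pow_mul_norm_sub {A : ℝ} {l j : ℕ} {k k' ζ ξ : E2} (hA : 1 ≤ A)
    (hkk' : A⁻¹ * (2 ^ l)⁻¹ ≤ setDist (square j k) (square l k')) (hζ : ζ ∈ square j k)
    (hξ : ξ ∈ square l k') : (2 * A ^ 2)⁻¹ ≤ 2 ^ l * ‖(ξ - ζ).ofLp‖ := by
  have hdist : A⁻¹ * (2 ^ l)⁻¹ ≤ 2 * ‖(ξ - ζ).ofLp‖ := by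
    refine hkk'.trans ((setDist_le_dist hζ hξ).trans ?_)
    rw [dist_comm, dist_eq_norm]
    exact norm_le_two_mul_norm_ofLp _
  calc (2 * A ^ 2)⁻¹ ≤ (2 * A)⁻¹ := by
        gcongr
        nlinarith
    _ = 2 ^ l * (A⁻¹ * (2 ^ l)⁻¹ / 2) := by field_simp
    _ ≤ 2 ^ l * ‖(ξ - ζ).ofLp‖ := by
        gcongr
        linarith

lemma comparable_wedge_of_mem_comp_perm {A θ : ℝ} {S : Fin 3 → Set E3}
    (hθ : ∀ p₁ ∈ S 0, ∀ p₂ ∈ S 1, ∀ p₃ ∈ S 2,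
      Comparable A (wedge (unitNormal p₁) (unitNormal p₂) (unitNormal p₃)) θ)
    (σ : Equiv.Perm (Fin 3)) {p : Fin 3 → E3} (hp : ∀ n, p n ∈ S (σ n)) :
    Comparable A (wedge (unitNormal (p 0)) (unitNormal (p 1)) (unitNormal (p 2))) θ := by
  have hmem : ∀ n, p (σ.symm n) ∈ S n := fun n => by simpa using hp (σ.symm n)
  rw [← wedge_comp_perm σ.symm fun n => unitNormal (p n)]
  exact hθ _ (hmem 0) _ (hmem 1) _ (hmem 2)

lemma inv_le_mul_abs_cross {A N : ℝ} (hA : 0 < A) (hN : 0 < N) {ξ₁ ξ₂ ξ₃ : E2}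
    (h : (A ^ 2 * N)⁻¹ ≤
      wedge (unitNormal (lift ξ₁)) (unitNormal (lift ξ₂)) (unitNormal (lift ξ₃))) :
    (2 * A ^ 2)⁻¹ ≤ N * |cross (ξ₂ - ξ₁).ofLp (ξ₃ - ξ₁).ofLp| :=
  calc (2 * A ^ 2)⁻¹ ≤ (A ^ 2)⁻¹ := by
        gcongr
        linarith [sq_nonneg A]
    _ = N * (A ^ 2 * N)⁻¹ := by field_simp
    _ ≤ _ := by
        gcongr
        exact h.trans (wedge_unitNormal_lift_le ξ₁ ξ₂ ξ₃)

lemma IsOfType.exists_frequencies {A : ℝ} {r j t : ℕ} {w m : E2} {𝒯 : Fin 3 → Finset Tube}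
    (h : IsOfType A r j t w m 𝒯) (hA : 1 ≤ A) :
    ∃ (σ : Equiv.Perm (Fin 3)) (k ω : Fin 3 → E2) (ξ : Fin 3 → Tube → E2),
      (∀ n, ∀ T ∈ 𝒯 (σ n), T.dir = unitNormal (lift (ξ n T)) ∧
        ξ n T ∈ square (![j, j, r] n) (k n) ∩ strip (![j, j, r] n + t) (ω n) m) ∧
      (∀ T : Fin 3 → Tube, (∀ n, T n ∈ 𝒯 (σ n)) → (A ^ 2 * (2 ^ j * 2 ^ r * 2 ^ t))⁻¹ ≤
        wedge (unitNormal (lift (ξ 0 (T 0)))) (unitNormal (lift (ξ 1 (T 1))))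
          (unitNormal (lift (ξ 2 (T 2))))) ∧
      m ∈ square j (k 0) ∧
      (∀ n ≠ 0, Comparable A (setDist (square j (k 0)) (square (![j, j, r] n) (k n)))
        (2 ^ ![j, j, r] n)⁻¹) ∧
      ∀ n, ‖ω n‖ = 1 ∧ ‖w - ω n‖ ≤ A * (2 ^ t)⁻¹ := by
  obtain ⟨hw, -, S, θ, -, hθ, hdir, σ, k, k', k'', w', hS₀, hS₁, hS₂, hm, hkk', -, hkk'', hw',
    hww', hθ'⟩ := h
  simp only [two_rpow_neg_natCast] at hkk' hkk'' hww' hθ'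
  have hS : ∀ n, S (σ n) ⊆ lift '' (square (![j, j, r] n) (![k, k', k''] n) ∩
      strip (![j, j, r] n + t) (![w, w, w'] n) m) := fun n =>
    match n with
    | 0 => hS₀
    | 1 => hS₁
    | 2 => hS₂
  have hfreq : ∀ n, ∀ T ∈ 𝒯 (σ n), ∃ ξ : E2, lift ξ ∈ S (σ n) ∧ T.dir = unitNormal (lift ξ) ∧
      ξ ∈ square (![j, j, r] n) (![k, k', k''] n) ∩
        strip (![j, j, r] n + t) (![w, w, w'] n) m := fun n T hT => by
    obtain ⟨p, hp, hTp⟩ := hdir _ T hT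
    obtain ⟨ξ, hξ, rfl⟩ := hS n hp
    exact ⟨ξ, hp, hTp, hξ⟩
  choose! ξ hξS hξ using hfreq
  refine ⟨σ, ![k, k', k''], ![w, w, w'], ξ, hξ, fun T hT => ?_, hm, fun n hn => ?_, fun n => ?_⟩
  · calc (A ^ 2 * (2 ^ j * 2 ^ r * 2 ^ t))⁻¹
        = A⁻¹ * (A⁻¹ * ((2 ^ j)⁻¹ * (2 ^ r)⁻¹ * (2 ^ t)⁻¹)) := by
          simp only [mul_inv, sq, mul_assoc]
      _ ≤ A⁻¹ * θ := mul_le_mul_of_nonneg_left hθ'.1 (by positivity)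
      _ ≤ _ := (comparable_wedge_of_mem_comp_perm hθ σ fun n => hξS n _ (hT n)).1
  · match n with
    | 1 => exact hkk'
    | 2 => exact hkk''
  · match n with
    | 0 | 1 => exact ⟨hw, (sub_self w).symm ▸ norm_zero.trans_le (by positivity)⟩
    | 2 => exact ⟨hw', hww'.2⟩

lemma setLIntegral_carrier_le_of_dir_eq {s : Fin 3 → Finset Tube} {ξ : Fin 3 → Tube → E2}
    (hdir : ∀ n, ∀ T ∈ s n, T.dir = unitNormal (lift (ξ n T)))
    (hξ : ∀ n, ∀ T ∈ s n, ∀ i, |ξ n T i| ≤ 2) (a : E3) (R : ℝ) :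
    ∫⁻ x in Metric.closedBall a R, trilinearIntegrand s (fun _ => Tube.carrier) x ≤
      ∫⁻ x in Metric.closedBall a.ofLp R, trilinearIntegrand s (fun n T =>
        graphTube 2 (fun _ => 3) (intercept 2 T.base.ofLp T.dir.ofLp) (-(ξ n T).ofLp)) x :=
  setLIntegral_closedBall_le_of_ofLp (fun _ => trilinearIntegrand_le_of_imp fun n T hT hx =>
    ⟨hT, ofLp_mem_graphTube (hdir n T hT) (hξ n T hT) hx⟩) a R

theorem exists_setLIntegral_carrier_le_of_isOfType {A ε : ℝ} (hA : 1 ≤ A) (hε : 0 < ε) :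
    ∃ B : ℝ, 0 ≤ B ∧ ∀ {r j t : ℕ} {w m : E2} {𝒯 : Fin 3 → Finset Tube},
      IsOfType A r j t w m 𝒯 → ∀ (a : E3) {R : ℝ}, 1 ≤ R →
        ∫⁻ x in Metric.closedBall a R, trilinearIntegrand 𝒯 (fun _ => Tube.carrier) x ≤
          ENNReal.ofReal (B * (R ^ ε * √(2 ^ j * 2 ^ t * 2 ^ r))) * sqrtCard 𝒯 := by
  obtain ⟨B, hB, hest⟩ := exists_setLIntegral_slab_le_of_frequencies hε
    (c := (2 * A ^ 2)⁻¹) (C := 1 + A * (A + 5)) (by positivity) (by nlinarith)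
  refine ⟨B, hB, fun {r j t w m 𝒯} htype a R hR => ?_⟩
  obtain ⟨σ, k, ω, ξ, hξ, hwedge, hm, hsep, hω⟩ := htype.exists_frequencies hA
  obtain ⟨hw, hrj, -⟩ := htype
  have hscale : ∀ n, (![2 ^ j, 2 ^ j, 2 ^ r] n : ℝ) = 2 ^ ![j, j, r] n ∧ ![j, j, r] n ≤ j :=
    fun n => match n with
    | 0 | 1 => ⟨rfl, le_rfl⟩
    | 2 => ⟨rfl, hrj⟩
  have hnear : ∀ n, setDist (square j (k 0)) (square (![j, j, r] n) (k n)) ≤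
      A * (2 ^ ![j, j, r] n)⁻¹ := fun n => by
    rcases eq_or_ne n 0 with rfl | hn
    · exact (setDist_le_dist hm hm).trans ((dist_self m).trans_le (by positivity))
    · exact (hsep n hn).2
  have hξ₂ : ∀ n, ∀ T ∈ 𝒯 (σ n), ∀ i, |ξ n T i| ≤ 2 := fun n T hT i => by
    obtain ⟨h₀, h₂⟩ := (hξ n T hT).2.2.1 i
    rwa [abs_of_nonneg h₀]
  simp only [← trilinearIntegrand_comp_perm σ 𝒯, ← sqrtCard_comp_perm σ 𝒯]
  refine (setLIntegral_carrier_le_of_dir_eq (s := 𝒯 ∘ σ) (fun n T hT => (hξ n T hT).1) hξ₂ a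
    R).trans ?_
  -- The unit normals point downwards: as a graph over the third axis, a tube has slopes `-ξ`.
  refine hest _ _ _ (w := w.ofLp) (m := -m.ofLp) ?_ (one_le_pow₀ one_le_two)
    (one_le_pow₀ one_le_two) (pow_le_pow_right₀ one_le_two hrj) hR (fun T hT i => ?_)
    (fun n T hT => ?_) (fun n hn T hT T₀ hT₀ => ?_) (fun T₀ hT₀ T₁ hT₁ T₂ hT₂ => ?_) _
  · rw [← norm_sq_eq_sq_add_sq, hw, one_pow]
  · rw [Pi.neg_apply, abs_neg]
    exact hξ₂ 0 T hT i
  · rw [(hscale n).1, neg_sub_neg, ← neg_sub, Matrix.mulVec_neg, norm_neg]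
    exact norm_anisotropic_mulVec_sub_le hA (hscale n).2 hw (hω n).1 (hω n).2 hm (hnear n)
      (hξ n T hT).2
  · rw [(hscale n).1, neg_sub_neg, norm_sub_rev]
    exact inv_le_two_pow_mul_norm_sub hA (hsep n hn).1 (hξ 0 T₀ hT₀).2.1 (hξ n T hT).2.1
  · rw [neg_sub_neg, neg_sub_neg, ← cross_neg_neg, neg_sub, neg_sub]
    exact inv_le_mul_abs_cross (by linarith) (by positivity)
      (hwedge ![T₀, T₁, T₂] fun n => match n with | 0 => hT₀ | 1 => hT₁ | 2 => hT₂)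

end Types

section Integral

variable {ι α : Type*} {s : Fin 3 → Finset ι} {U : Fin 3 → ι → Set α}

lemma setLIntegral_closedBall_le_sqrtCard {m : Type*} [Fintype m]
    (U : Fin 3 → ι → Set (EuclideanSpace ℝ m)) (a : EuclideanSpace ℝ m) {R : ℝ} (hR : 0 ≤ R) :
    ∫⁻ x in Metric.closedBall a R, trilinearIntegrand s U x ≤
      ENNReal.ofReal ((2 * R) ^ Fintype.card m) * sqrtCard s := by
  refine (setLIntegral_closedBall_le_of_ofLp (g := fun _ => sqrtCard s)
    (trilinearIntegrand_le_sqrtCard s U) a R).trans ?_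
  rw [setLIntegral_const, Real.volume_pi_closedBall _ hR, mul_comm]

lemma ofReal_prod_rpow {n : Type*} [Fintype n] {f : n → ℝ} (hf : ∀ i, 0 ≤ f i) {p : ℝ}
    (hp : 0 ≤ p) : ENNReal.ofReal (∏ i, f i ^ p) = ∏ i, ENNReal.ofReal (f i) ^ p := by
  rw [ENNReal.ofReal_prod_of_nonneg fun i _ => Real.rpow_nonneg (hf i) p]
  exact Finset.prod_congr rfl fun i _ => (ENNReal.ofReal_rpow_of_nonneg (hf i) hp).symm

lemma sqrtCard_eq_ofReal (s : Fin 3 → Finset ι) :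
    sqrtCard s = ENNReal.ofReal (∏ n, ((s n).card : ℝ) ^ (1 / 2 : ℝ)) := by
  simp [sqrtCard, ofReal_prod_rpow]

lemma trilinearIntegrand_eq_ofReal (s : Fin 3 → Finset ι) (U : Fin 3 → ι → Set α) (x : α) :
    trilinearIntegrand s U x = ENNReal.ofReal
      (∏ n, (∑ i ∈ s n, (U n i).indicator (fun _ => (1 : ℝ)) x) ^ (1 / 2 : ℝ)) := by
  classical
  have hnonneg : ∀ n i, 0 ≤ (U n i).indicator (fun _ => (1 : ℝ)) x := fun n i =>
    Set.indicator_nonneg (fun _ _ => zero_le_one) x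
  rw [ofReal_prod_rpow (fun n => Finset.sum_nonneg fun i _ => hnonneg n i) (by norm_num)]
  refine Finset.prod_congr rfl fun n _ => congrArg (· ^ (1 / 2 : ℝ)) ?_
  rw [multiplicity, ENNReal.ofReal_sum_of_nonneg fun i _ => hnonneg n i]
  refine Finset.sum_congr rfl fun i _ => ?_
  by_cases hx : x ∈ U n i <;> simp [hx]

lemma integral_le_of_lintegral_trilinearIntegrand_le [MeasurableSpace α] {μ : Measure α} {K : ℝ}
    (hK : 0 ≤ K)
    (h : ∫⁻ x, trilinearIntegrand s U x ∂μ ≤ ENNReal.ofReal K * sqrtCard s) :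
    ∫ x, ∏ n, (∑ i ∈ s n, (U n i).indicator (fun _ => (1 : ℝ)) x) ^ (1 / 2 : ℝ) ∂μ ≤
      K * ∏ n, ((s n).card : ℝ) ^ (1 / 2 : ℝ) := by
  have hnonneg : ∀ x, 0 ≤ ∏ n, (∑ i ∈ s n, (U n i).indicator (fun _ => (1 : ℝ)) x) ^ (1 / 2 : ℝ) :=
    fun x => Finset.prod_nonneg fun n _ => Real.rpow_nonneg
      (Finset.sum_nonneg fun i _ => Set.indicator_nonneg (fun _ _ => zero_le_one) x) _
  refine (Real.le_norm_self _).trans ((norm_integral_le_lintegral_norm _).trans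
    (ENNReal.toReal_le_of_le_ofReal (mul_nonneg hK (by positivity)) ?_))
  simp_rw [Real.norm_of_nonneg (hnonneg _), ← trilinearIntegrand_eq_ofReal, ENNReal.ofReal_mul hK,
    ← sqrtCard_eq_ofReal]
  exact h

lemma sqrt_two_pow_mul (j t r : ℕ) :
    √(2 ^ j * 2 ^ t * 2 ^ r) = (2 : ℝ) ^ (((j : ℝ) + t + r) / 2) := by
  rw [← pow_add, ← pow_add, Real.sqrt_eq_rpow, ← Real.rpow_natCast, ← Real.rpow_mul two_pos.le]
  push_cast
  ring_nf

lemma two_mul_pow_three_le {R ε B Z : ℝ} (hR : 0 < R) (hR₁ : R ≤ 1) (hε : ε ≤ 3) (hB : 8 ≤ B)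
    (hZ : 1 ≤ Z) : (2 * R) ^ 3 ≤ B * R ^ ε * Z :=
  calc (2 * R) ^ 3 = 8 * R ^ (3 : ℝ) * 1 := by
        rw [← Real.rpow_natCast, Real.mul_rpow zero_le_two hR.le]
        norm_num
    _ ≤ B * R ^ ε * Z := by
        gcongr ?_ * ?_ * ?_
        exact Real.rpow_le_rpow_of_exponent_ge hR hR₁ hε

end Integral

end TrilinearKakeya

open MeasureTheory TrilinearKakeya in
theorem mainTheorem2 (A : ℝ) (hA : 1 ≤ A) (ε : ℝ) (hε : 0 < ε) :
    ∃ C : ℝ, ∀ (r j t : ℕ) (w m : E2) (𝒯 : Fin 3 → Finset Tube),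
      IsOfType A r j t w m 𝒯 →
      ∀ (a : E3) (R : ℝ), 0 < R → (1 ≤ R ∨ ε ≤ 3) →
        ∫ x in Metric.closedBall a R,
            ∏ n, (∑ T ∈ 𝒯 n, T.carrier.indicator (fun _ => (1 : ℝ)) x) ^ (1 / 2 : ℝ)
          ≤ C * R ^ ε * (2 : ℝ) ^ (((j : ℝ) + t + r) / 2) *
              ∏ n, ((𝒯 n).card : ℝ) ^ (1 / 2 : ℝ) := by
  obtain ⟨B, hB, hlarge⟩ := exists_setLIntegral_carrier_le_of_isOfType hA hε
  refine ⟨B + 8, fun r j t w m 𝒯 htype a R hR hRε => ?_⟩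
  refine integral_le_of_lintegral_trilinearIntegrand_le (U := fun _ => Tube.carrier)
    (by positivity) ?_
  rcases le_or_gt 1 R with hR₁ | hR₁
  · refine (hlarge htype a hR₁).trans ?_
    rw [sqrt_two_pow_mul]
    rw [← mul_assoc]
    gcongr
    exact le_add_of_nonneg_right (by norm_num)
  · refine (setLIntegral_closedBall_le_sqrtCard _ a hR.le).trans ?_
    gcongr ENNReal.ofReal ?_ * _
    exact two_mul_pow_three_le hR hR₁.le (hRε.resolve_left hR₁.not_ge) (by linarith)
      (Real.one_le_rpow one_le_two (by positivity))
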